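/- For a real number $p>1$ and $b\in[0,1]$ put $$R(p,b):=\bigl(b^{p-1}+(1-b)^{p-1}\bigr)\bigl(b^{1/(p-1)}+(1-b)^{1/(p-1)}\bigr)^{p-1},$$ for $b\in(0,1)$ put $t_b=t_{p,b}:=b-\dfrac{b^{1/(p-1)}}{b^{1/(p-1)}+(1-b)^{1/(p-1)}}$, and let $$C_p:=\sup\Bigl\{\frac{a\,|b|^p+b\,|-a|^p}{a\,|b-t|^p+b\,|-a-t|^p}\colon a>0,\ b>0,\ t\in\mathbb R\Bigr\}.$$ For $a,b>0$ let $X_{a,b}$ denote the zero-mean random variable with values $-a$ and $b$, so that $\mathsf P(X_{a,b}=b)=\frac a{a+b}=1-\mathsf P(X_{a,b}=-a)$. If $p>1$ and $p\ne2$, there is exactly one $b_p\in(0,\frac12)$ such that $\frac{\partial R(p,b)}{\partial b}>0$ for $b\in(0,b_p)$ and $\frac{\partial R(p,b)}{\partial b}<0$ for $b\in(b_p,\frac12)$; so $R(p,\cdot)$ is strictly increasing on $[0,b_p]$ and strictly decreasing on $[b_p,\frac12]$, and $b_p$ is the unique maximizer of $R(p,\cdot)$ on $[0,\frac12]$. Moreover: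 (i) For all $p>1$, $C_p<\infty$, and every real random variable $X$ with a finite mean satisfies $$\mathsf E|X-\mathsf EX|^p\le C_p\,\mathsf E|X|^p \qquad (*)$$ (both sides in $[0,\infty]$), and $C_p=\sup_{b\in[0,1]}R(p,b)=\max_{b\in(0,1/2)}R(p,b)$, which equals $R(p,b_p)$ if $p\neq2$. In particular $C_2=R(2,b)=1$ for all $b\in[0,1]$. (ii) For all $p>1$, $C_p$ is the best possible constant factor in $(*)$ over all random variables $X$ with a finite mean. For a random variable $X$ with a finite mean, equality holds in $(*)$ if and only if one of the following holds: (a) $\mathsf E|X|^p=\infty$; (b) $p=2$, $\mathsf EX^2<\infty$ and $\mathsf EX=0$; (c) $p\ne2$ and $X$ is equal in distribution to $\lambda(X_{1-b_p,b_p}-t_{b_p})$ for some $\lambda\in\mathbb R$, where $t_{b_p}=t_{p,b_p}$. (iii) If $p>1$ and $\frac1p+\frac1q=1$, then $C_p^{1/\sqrt{p-1}}=C_q^{1/\sqrt{q-1}}$, and $b_p=b_q$ if $p\ne2$. (iv) $C_p\Big/\dfrac{2^p}{\sqrt{8ep}}\to1$ as $p\to\infty$. (v) $C_p>0$ for $p>1$,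 the function $p\mapsto\ln C_p$ is strictly convex on $(1,\infty)$, and $p\mapsto C_p$ is continuous on $(1,\infty)$; $C_p$ is strictly decreasing in $p\in(1,2]$ with $C_p\to2$ as $p\downarrow1$ and $C_2=1$, and strictly increasing in $p\in[2,\infty)$ with $C_p\to\infty$ as $p\to\infty$. (vi) For every rational $p>1$, $C_p$ is algebraic, and, if $p\ne2$, so are $b_p$ and $t_{b_p}$. In particular, for $p=3$: $C_3=\frac1{27}(17+7\sqrt7)=1.315\ldots$, $b_3=\frac12-\frac16\sqrt{1+2\sqrt7}=0.0819\ldots$, and $t_{b_3}=-\frac13\sqrt{\frac12(13\sqrt7-34)}=-0.148\ldots$. -/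

import Mathlib

open Set Filter Topology MeasureTheory
open scoped ENNReal

universe u

noncomputable section

/-- The constant `c_f ∈ [0, ∞]`: the supremum over `a > 0`, `b > 0` and real `t` of
`(a f(b) + b f(-a)) / (a f(b - t) + b f(-a - t))`. -/
def recenterConst (f : ℝ → ℝ) : ℝ≥0∞ :=
  ⨆ (a : ℝ) (b : ℝ) (t : ℝ) (_ : 0 < a) (_ : 0 < b),
    ENNReal.ofReal ((a * f b + b * f (-a)) / (a * f (b - t) + b * f (-a - t)))

/-- `C_p`, the constant `c_f` for `f = |·|^p`, as a real number
(its finiteness is part of the theorem). -/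
def recenterC (p : ℝ) : ℝ := (recenterConst fun x => |x| ^ p).toReal

/-- `R(p, b)`. -/
def recenterR (p b : ℝ) : ℝ :=
  (b ^ (p - 1) + (1 - b) ^ (p - 1)) *
    (b ^ (1 / (p - 1)) + (1 - b) ^ (1 / (p - 1))) ^ (p - 1)

/-- `b ∈ (0, 1/2)`, and the derivative of `R(p, ·)` is positive on `(0, b)` and negative on
`(b, 1/2)`. (At most one `b` has this property; a nonzero value of `deriv` entails
differentiability.) -/
def IsRecenterPeak (p b : ℝ) : Prop :=
  b ∈ Ioo (0 : ℝ) (1 / 2) ∧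
    (∀ x ∈ Ioo (0 : ℝ) b, 0 < deriv (recenterR p) x) ∧
    (∀ x ∈ Ioo b (1 / 2 : ℝ), deriv (recenterR p) x < 0)

/-- `b_p`, for `p ≠ 2`: the element of a set with at most one element
(that it is inhabited is part of the theorem). -/
def recenterB (p : ℝ) : ℝ := sSup {b | IsRecenterPeak p b}

/-- `t_b` (for the exponent `p`). -/
def recenterT (p b : ℝ) : ℝ :=
  b - b ^ (1 / (p - 1)) / (b ^ (1 / (p - 1)) + (1 - b) ^ (1 / (p - 1)))

/-- The law of `X_{a,b}`, the zero-mean random variable with values `-a` and `b`. -/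
def twoPointLaw (a b : ℝ) : Measure ℝ :=
  ENNReal.ofReal (b / (a + b)) • Measure.dirac (-a) +
    ENNReal.ofReal (a / (a + b)) • Measure.dirac b

/-- `E |X|^p ∈ [0, ∞]`. -/
def absMoment {Ω : Type u} [MeasurableSpace Ω] (P : Measure Ω) (p : ℝ) (X : Ω → ℝ) : ℝ≥0∞ :=
  ∫⁻ ω, ENNReal.ofReal (|X ω| ^ p) ∂P

end

/-!
Put `s = p - 1` and parametrize `b ∈ (0, 1)` by the half log-odds `u = log ((1 - b) / b) / 2`. Then
`log R(p, b) = L (s u) + s L (u / s) - (s + 1) L u` with `L = log cosh` (`recenterR_eq_exp`). The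
expression for the conjugate exponent, where `s` becomes `1 / s`, is this one divided by `s`: that
is the duality between `p` and `q`, and it reduces the shape of `R(p, ·)` to the case `s > 1`.

*Shape of `R(p, ·)`.* Up to a positive factor, the derivative in `u` is `-f` with
`f u = sinh (A u) - (s + 1) sinh (B u) - s sinh (D u)`, `A = s + 1 - 1/s`, `B = s - 1 + 1/s`,
`D = s - 1 - 1/s`. For these constants `f'' - B² f = 4 (s - 1) (sinh (A u) + sinh (D u)) > 0`, so
the Wronskian of `f` and `sinh (B ·)` is positive and `f / sinh (B ·)` increases strictly
(`strictMonoOn_logRSlopeNum_div`); it is negative near `0` and positive far out, hence has exactly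
one zero, which gives `b_p`.

*The inequality.* Among `t`, the moment `E|X_{1-b,b} - t|^p` is minimal at `t_b` only, by tangent
lines to `|·|^p` (`weighted_moment_min`); so `C_p = max R(p, ·)`, with equality for two-point laws
exactly at the maximizers (`twoPoint_bound`). For fixed `t`, the two-point inequality says that
`g y = |y|^p - C_p |y - t|^p` satisfies `g b / b ≤ -g (-a) / a` for all `a, b > 0`; a number `l` in
between gives `g y ≤ l y` for all `y` (`exists_line`), and the general inequality follows by
integrating this at `X - EX` with `t = -EX`. In the case of equality `X - EX` lives on the contact
set `g y = l y`, and a positive and a negative contact point form an extremal two-point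
configuration, which is determined by `t` when `t ≠ 0` (`exists_map_eq_of_centered_eq`).

*Dependence on `p`.* For large `s` the main term of `R` is `2^s √b exp (-s b)`, which is maximal at
`b = 1 / (2 s)`; this gives the asymptotics. For fixed `u ≠ 0`, `s ↦ L (s u)` is strictly convex and
`s ↦ s L (u / s)` is a perspective of `L`, hence convex; as the supremum over `u` is attained,
`log C_p` is strictly convex. It is positive for `p ≠ 2` and vanishes at `2`, whence the
monotonicity; the limit at `1` is dual to the growth rate at `∞`. For `s = m / n`, the number
`y = exp (-2 u / (m n))` at `b = b_p` is a root of a nonzero rational polynomial (`critPoly`).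
-/

namespace Recenter

/-! ### Sign changes of the logarithmic derivative -/

/-- The derivative in `u` of `log (cosh (s u)) + s log (cosh (u / s)) - (s + 1) log (cosh u)`. -/
noncomputable def logRSlope (s u : ℝ) : ℝ :=
  s * Real.tanh (s * u) + Real.tanh (u / s) - (s + 1) * Real.tanh u

lemma logRSlope_inv {s : ℝ} (hs : 0 < s) (u : ℝ) : logRSlope s⁻¹ u = logRSlope s u / s := by
  have h1 : s⁻¹ * u = u / s := by field_simp
  have h2 : u / s⁻¹ = s * u := by field_simp
  simp only [logRSlope, h1, h2]
  field_simp
  ring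

lemma tanh_strictMono : StrictMono Real.tanh := by
  intro x y h
  have := Real.cosh_pos x
  have := Real.cosh_pos y
  have h1 := Real.sinh_pos_iff.2 (sub_pos.2 h)
  rw [Real.sinh_sub] at h1
  rw [Real.tanh_eq_sinh_div_cosh, Real.tanh_eq_sinh_div_cosh, div_lt_div_iff₀ (by assumption)
    (by assumption)]
  linarith

/-- The numerator of `-logRSlope s u`, up to a positive factor. -/
noncomputable def logRSlopeNum (s u : ℝ) : ℝ :=
  Real.sinh ((s + 1 - 1 / s) * u) - (s + 1) * Real.sinh ((s - 1 + 1 / s) * u)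
    - s * Real.sinh ((s - 1 - 1 / s) * u)

lemma logRSlope_eq_logRSlopeNum {s : ℝ} (hs : 0 < s) (u : ℝ) :
    logRSlope s u =
      -logRSlopeNum s u / (2 * Real.cosh (s * u) * Real.cosh (u / s) * Real.cosh u) := by
  have e1 : (s + 1 - 1 / s) * u = s * u + u - u / s := by field_simp
  have e2 : (s - 1 + 1 / s) * u = s * u - u + u / s := by field_simp
  have e3 : (s - 1 - 1 / s) * u = s * u - u - u / s := by field_simp
  have := (Real.cosh_pos (s * u)).ne'
  have := (Real.cosh_pos (u / s)).ne'
  have := (Real.cosh_pos u).ne'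
  simp only [logRSlope, logRSlopeNum, e1, e2, e3, Real.sinh_add, Real.sinh_sub, Real.cosh_add,
    Real.cosh_sub, Real.tanh_eq_sinh_div_cosh]
  field_simp
  ring

lemma hasDerivAt_sinh_mul (a u : ℝ) :
    HasDerivAt (fun u => Real.sinh (a * u)) (a * Real.cosh (a * u)) u := by
  have := ((hasDerivAt_id u).const_mul a).sinh
  simpa [mul_comm] using this

lemma hasDerivAt_cosh_mul (a u : ℝ) :
    HasDerivAt (fun u => Real.cosh (a * u)) (a * Real.sinh (a * u)) u := by
  have := ((hasDerivAt_id u).const_mul a).cosh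
  simpa [mul_comm] using this

/-- With `B = s - 1 + 1 / s`, the function `f = logRSlopeNum s` satisfies `f'' > B² f` on `(0, ∞)`,
so its Wronskian with `sinh (B ·)`, which vanishes at `0`, is positive there. -/
lemma strictMonoOn_logRSlopeNum_div {s : ℝ} (hs : 1 < s) :
    StrictMonoOn (fun u => logRSlopeNum s u / Real.sinh ((s - 1 + 1 / s) * u)) (Ioi 0) := by
  have hs0 : 0 < s := by linarith
  set A := s + 1 - 1 / s with hA
  set B := s - 1 + 1 / s with hB
  set D := s - 1 - 1 / s with hD
  have hi : 0 < 1 / s := by positivity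
  have hi1 : 1 / s < 1 := by rw [div_lt_one hs0]; exact hs
  have hsi : s * (1 / s) = 1 := by field_simp
  have hBpos : 0 < B := by linarith
  let f : ℝ → ℝ := fun u => Real.sinh (A * u) - (s + 1) * Real.sinh (B * u) - s * Real.sinh (D * u)
  let f' : ℝ → ℝ := fun u => A * Real.cosh (A * u) - (s + 1) * (B * Real.cosh (B * u))
    - s * (D * Real.cosh (D * u))
  let f'' : ℝ → ℝ := fun u => A * (A * Real.sinh (A * u)) - (s + 1) * (B * (B * Real.sinh (B * u)))
    - s * (D * (D * Real.sinh (D * u)))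
  have hf : ∀ u, HasDerivAt f (f' u) u := fun u =>
    ((hasDerivAt_sinh_mul A u).sub ((hasDerivAt_sinh_mul B u).const_mul _)).sub
      ((hasDerivAt_sinh_mul D u).const_mul _)
  have hf' : ∀ u, HasDerivAt f' (f'' u) u := fun u =>
    (((hasDerivAt_cosh_mul A u).const_mul _).sub
      (((hasDerivAt_cosh_mul B u).const_mul _).const_mul _)).sub
      (((hasDerivAt_cosh_mul D u).const_mul _).const_mul _)
  let N : ℝ → ℝ := fun u => f' u * Real.sinh (B * u) - f u * (B * Real.cosh (B * u))
  have hN : ∀ u, HasDerivAt N ((f'' u - B ^ 2 * f u) * Real.sinh (B * u)) u := fun u => by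
    have := ((hf' u).mul (hasDerivAt_sinh_mul B u)).sub
      ((hf u).mul ((hasDerivAt_cosh_mul B u).const_mul B))
    refine this.congr_deriv ?_
    ring
  have key : ∀ u, f'' u - B ^ 2 * f u =
      4 * (s - 1) * (Real.sinh (A * u) + Real.sinh (D * u)) := fun u => by
    have e1 : A ^ 2 - B ^ 2 = 4 * (s - 1) := by
      rw [hA, hB]; field_simp; ring
    have e2 : s * (B ^ 2 - D ^ 2) = 4 * (s - 1) := by
      rw [hD, hB]; field_simp; ring
    simp only [f, f'']
    linear_combination Real.sinh (A * u) * e1 + Real.sinh (D * u) * e2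
  have hNpos : ∀ u, 0 < u → 0 < N u := by
    have hmono : StrictMonoOn N (Ici 0) := by
      apply strictMonoOn_of_deriv_pos (convex_Ici 0)
      · exact fun u _ => (hN u).continuousAt.continuousWithinAt
      · intro u hu
        rw [interior_Ici] at hu
        have hu : 0 < u := hu
        rw [(hN u).deriv, key u]
        have h1 : -Real.sinh (D * u) < Real.sinh (A * u) := by
          rw [← Real.sinh_neg, Real.sinh_lt_sinh]
          nlinarith
        have h2 : 0 < Real.sinh (B * u) := Real.sinh_pos_iff.2 (by positivity)
        have h3 : 0 < s - 1 := by linarith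
        have h4 : 0 < Real.sinh (A * u) + Real.sinh (D * u) := by linarith
        positivity
    intro u hu
    have := hmono self_mem_Ici hu.le hu
    simpa [N, f] using this
  have hpos : ∀ u ∈ Ioi (0 : ℝ), 0 < Real.sinh (B * u) := fun u hu =>
    Real.sinh_pos_iff.2 (mul_pos hBpos hu)
  have hw : ∀ u ∈ Ioi (0 : ℝ), HasDerivAt (fun u => f u / Real.sinh (B * u))
      (N u / Real.sinh (B * u) ^ 2) u := fun u hu =>
    (hf u).div (hasDerivAt_sinh_mul B u) (hpos u hu).ne'
  apply strictMonoOn_of_deriv_pos (convex_Ioi 0)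
  · exact fun u hu => (hw u hu).continuousAt.continuousWithinAt
  · intro u hu
    rw [interior_Ioi] at hu
    have h := (hw u hu).deriv
    change 0 < deriv (fun u => f u / Real.sinh (B * u)) u
    rw [h]
    exact div_pos (hNpos u hu) (by have := hpos u hu; positivity)

lemma continuous_logRSlopeNum (s : ℝ) : Continuous (logRSlopeNum s) := by
  unfold logRSlopeNum
  fun_prop

/-- The derivative of `logRSlopeNum s` at `0` is `-2 (s - 1) (s - 1 / s) < 0`. -/
lemma exists_logRSlopeNum_neg {s : ℝ} (hs : 1 < s) : ∃ u, 0 < u ∧ logRSlopeNum s u < 0 := by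
  have hs0 : 0 < s := by linarith
  have hd : HasDerivAt (logRSlopeNum s) (-2 * (s - 1) * (s - 1 / s)) 0 := by
    have := ((hasDerivAt_sinh_mul (s + 1 - 1 / s) 0).sub
      ((hasDerivAt_sinh_mul (s - 1 + 1 / s) 0).const_mul (s + 1))).sub
      ((hasDerivAt_sinh_mul (s - 1 - 1 / s) 0).const_mul s)
    refine this.congr_deriv ?_
    simp only [mul_zero, Real.cosh_zero, mul_one]
    field_simp
    ring
  have hneg : -2 * (s - 1) * (s - 1 / s) < 0 := by
    have : 1 / s < 1 := by rw [div_lt_one hs0]; exact hs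
    have := mul_pos (sub_pos.2 hs) (by linarith : 0 < s - 1 / s)
    linarith
  have h0 : logRSlopeNum s 0 = 0 := by simp [logRSlopeNum]
  have h1 := (hasDerivAt_iff_tendsto_slope.1 hd).eventually (eventually_lt_nhds hneg)
  have h2 : ∀ᶠ u in 𝓝[>] (0 : ℝ), slope (logRSlopeNum s) 0 u < 0 :=
    h1.filter_mono (nhdsWithin_mono _ (fun x hx => (ne_of_gt hx)))
  obtain ⟨u, hu, hu0⟩ := (h2.and self_mem_nhdsWithin).exists
  have hu0 : 0 < u := hu0
  refine ⟨u, hu0, ?_⟩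
  rw [slope_def_field, h0, sub_zero, sub_zero, div_lt_iff₀ hu0, zero_mul] at hu
  exact hu

/-- The term `sinh (A u)` dominates: with `δ = A - B > 0` it is at least `cosh (δ u) sinh (B u)`,
and the other two terms together are at most `(2 s + 1) sinh (B u)`. -/
lemma exists_logRSlopeNum_pos {s : ℝ} (hs : 1 < s) : ∃ u, 0 < u ∧ 0 < logRSlopeNum s u := by
  have hs0 : 0 < s := by linarith
  have hi : 0 < 1 / s := by positivity
  have hi1 : 1 / s < 1 := by rw [div_lt_one hs0]; exact hs
  set δ := 2 * (1 - 1 / s) with hδ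
  have hδ0 : 0 < δ := by linarith
  -- a choice with `exp (δ u) ≥ δ u + 1 > 2 (2 s + 1)`, so that `cosh (δ u) > 2 s + 1`
  set u := 2 * (2 * s + 1) / δ with hu
  have hu0 : 0 < u := by positivity
  refine ⟨u, hu0, ?_⟩
  have hδu : δ * u = 2 * (2 * s + 1) := by rw [hu]; field_simp
  set x := (s - 1 + 1 / s) * u with hx
  have hx0 : 0 < x := mul_pos (by linarith) hu0
  have hA : (s + 1 - 1 / s) * u = x + δ * u := by rw [hx, hδ]; ring
  have hD : Real.sinh ((s - 1 - 1 / s) * u) ≤ Real.sinh x :=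
    Real.sinh_le_sinh.2 (by rw [hx]; nlinarith)
  have h1 : 2 * s + 1 < Real.cosh (δ * u) := by
    have := Real.add_one_le_exp (δ * u)
    have := Real.exp_pos (-(δ * u))
    rw [Real.cosh_eq]
    linarith
  have h2 : 0 < Real.sinh x := Real.sinh_pos_iff.2 hx0
  have h3 : 0 < Real.cosh x * Real.sinh (δ * u) :=
    mul_pos (Real.cosh_pos x) (Real.sinh_pos_iff.2 (mul_pos hδ0 hu0))
  unfold logRSlopeNum
  rw [hA, ← hx, Real.sinh_add]
  have h4 := mul_lt_mul_of_pos_left h1 h2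
  have h5 := mul_le_mul_of_nonneg_left hD hs0.le
  nlinarith

/-- `logRSlope s` changes sign exactly once on `(0, ∞)`, for `s > 1`. -/
lemma exists_logRSlope_sign_of_one_lt {s : ℝ} (hs : 1 < s) :
    ∃ v, 0 < v ∧ (∀ u, 0 < u → u < v → 0 < logRSlope s u) ∧ ∀ u, v < u → logRSlope s u < 0 := by
  have hs0 : 0 < s := by linarith
  have hi : 0 < 1 / s := by positivity
  have hB : 0 < s - 1 + 1 / s := by linarith
  obtain ⟨u₁, hu₁, h₁⟩ := exists_logRSlopeNum_neg hs
  obtain ⟨u₂, hu₂, h₂⟩ := exists_logRSlopeNum_pos hs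
  have hmono := strictMonoOn_logRSlopeNum_div hs
  set w := fun u => logRSlopeNum s u / Real.sinh ((s - 1 + 1 / s) * u) with hw
  have hsh : ∀ u, 0 < u → 0 < Real.sinh ((s - 1 + 1 / s) * u) := fun u hu =>
    Real.sinh_pos_iff.2 (mul_pos hB hu)
  have hden : ∀ u, 0 < 2 * Real.cosh (s * u) * Real.cosh (u / s) * Real.cosh u := fun u => by
    have := Real.cosh_pos (s * u)
    have := Real.cosh_pos (u / s)
    have := Real.cosh_pos u
    positivity
  have hw1 : w u₁ < 0 := div_neg_of_neg_of_pos h₁ (hsh _ hu₁)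
  have hw2 : 0 < w u₂ := div_pos h₂ (hsh _ hu₂)
  have h12 : u₁ < u₂ := (hmono.lt_iff_lt hu₁ hu₂).1 (hw1.trans hw2)
  have hcont : ContinuousOn w (Icc u₁ u₂) := by
    apply (continuous_logRSlopeNum s).continuousOn.div (by fun_prop)
    intro u hu
    exact (hsh u (hu₁.trans_le hu.1)).ne'
  obtain ⟨v, hv, hv0⟩ := intermediate_value_Icc h12.le hcont ⟨hw1.le, hw2.le⟩
  have hvpos : 0 < v := hu₁.trans_le hv.1
  refine ⟨v, hvpos, ?_, ?_⟩
  · intro u hu huv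
    have : w u < 0 := hv0 ▸ hmono hu hvpos huv
    have : logRSlopeNum s u < 0 := by
      have h := (div_lt_iff₀ (hsh u hu)).1 this
      simpa using h
    rw [logRSlope_eq_logRSlopeNum hs0]
    exact div_pos (by linarith) (hden u)
  · intro u huv
    have hu : 0 < u := hvpos.trans huv
    have : 0 < w u := hv0 ▸ hmono hvpos hu huv
    have : 0 < logRSlopeNum s u := by
      have h := (lt_div_iff₀ (hsh u hu)).1 this
      simpa using h
    rw [logRSlope_eq_logRSlopeNum hs0]
    exact div_neg_of_neg_of_pos (by linarith) (hden u)

lemma exists_logRSlope_sign {s : ℝ} (hs0 : 0 < s) (hs1 : s ≠ 1) :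
    ∃ v, 0 < v ∧ (∀ u, 0 < u → u < v → 0 < logRSlope s u) ∧ ∀ u, v < u → logRSlope s u < 0 := by
  rcases lt_or_gt_of_ne hs1 with h | h
  · obtain ⟨v, hv, h1, h2⟩ := exists_logRSlope_sign_of_one_lt ((one_lt_inv₀ hs0).2 h)
    have hi : 0 < s⁻¹ := inv_pos.2 hs0
    have e : ∀ u, logRSlope s u = logRSlope s⁻¹ u * s := fun u => by
      rw [logRSlope_inv hs0]; field_simp
    refine ⟨v, hv, fun u h3 h4 => ?_, fun u h3 => ?_⟩
    · rw [e]; exact mul_pos (h1 u h3 h4) hs0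
    · rw [e]; exact mul_neg_of_neg_of_pos (h2 u h3) hs0
  · exact exists_logRSlope_sign_of_one_lt h

/-! ### The shape of `R(p, ·)` -/

/-- `log R(p, b)` as a function of `s = p - 1` and `u = halfLogit b`. -/
noncomputable def logR (s u : ℝ) : ℝ :=
  Real.log (Real.cosh (s * u)) + s * Real.log (Real.cosh (u / s))
    - (s + 1) * Real.log (Real.cosh u)

/-- Half of the log-odds of `1 - b`: the `u` with `b / (1 - b) = exp (-2 u)`. -/
noncomputable def halfLogit (b : ℝ) : ℝ := Real.log ((1 - b) / b) / 2

/-- The inverse of `halfLogit`. -/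
noncomputable def halfLogistic (u : ℝ) : ℝ := Real.exp (-u) / (2 * Real.cosh u)

lemma one_sub_halfLogistic (u : ℝ) :
    1 - halfLogistic u = Real.exp u / (2 * Real.cosh u) := by
  have := Real.cosh_pos u
  unfold halfLogistic
  rw [eq_div_iff (by positivity), sub_mul, div_mul_cancel₀ _ (by positivity), Real.cosh_eq]
  ring

lemma halfLogistic_mem (u : ℝ) : halfLogistic u ∈ Ioo (0 : ℝ) 1 := by
  have h0 := Real.cosh_pos u
  constructor
  · unfold halfLogistic; positivity
  · have : 0 < 1 - halfLogistic u := by rw [one_sub_halfLogistic]; positivity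
    linarith

lemma halfLogit_halfLogistic (u : ℝ) : halfLogit (halfLogistic u) = u := by
  have h0 := Real.cosh_pos u
  unfold halfLogit
  rw [one_sub_halfLogistic, halfLogistic, div_div_div_cancel_right₀ (by positivity),
    ← Real.exp_sub, Real.log_exp]
  ring

lemma halfLogistic_halfLogit {b : ℝ} (hb : b ∈ Ioo (0 : ℝ) 1) :
    halfLogistic (halfLogit b) = b := by
  obtain ⟨h0, h1⟩ := hb
  set u := halfLogit b with hu
  have h2 : 0 < 1 - b := by linarith
  have e : Real.exp u * Real.exp u = (1 - b) / b := by
    rw [← Real.exp_add, hu, halfLogit, add_halves, Real.exp_log (by positivity)]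
  have e2 : Real.exp u * Real.exp u * b = 1 - b := by rw [e]; field_simp
  have e3 : Real.exp u * Real.exp (-u) = 1 := by rw [← Real.exp_add]; simp
  have := Real.exp_pos u
  have := Real.exp_pos (-u)
  unfold halfLogistic
  rw [Real.cosh_eq, div_eq_iff (by positivity)]
  apply mul_left_cancel₀ (Real.exp_pos u).ne'
  linear_combination (1 - b) * e3 - e2

lemma halfLogit_strictAntiOn : StrictAntiOn halfLogit (Ioo 0 1) := by
  intro a ha b hb hab
  unfold halfLogit
  have h1 : 0 < 1 - b := by linarith [hb.2]
  have : (1 - b) / b < (1 - a) / a := by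
    rw [div_lt_div_iff₀ hb.1 ha.1]; linarith
  have := Real.log_lt_log (div_pos h1 hb.1) this
  linarith

lemma halfLogit_half : halfLogit (1 / 2) = 0 := by norm_num [halfLogit]

lemma halfLogistic_pos_lt_half {u : ℝ} (hu : 0 < u) : halfLogistic u ∈ Ioo (0 : ℝ) (1 / 2) := by
  refine ⟨(halfLogistic_mem u).1, ?_⟩
  rw [← halfLogit_strictAntiOn.lt_iff_gt (by norm_num) (halfLogistic_mem u), halfLogit_half,
    halfLogit_halfLogistic]
  exact hu

lemma halfLogit_pos {b : ℝ} (hb : b ∈ Ioo (0 : ℝ) (1 / 2)) : 0 < halfLogit b := by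
  rw [← halfLogit_half]
  exact halfLogit_strictAntiOn ⟨hb.1, by linarith [hb.2]⟩ (by norm_num) hb.2

lemma rpow_halfLogistic_add (u r : ℝ) :
    halfLogistic u ^ r + (1 - halfLogistic u) ^ r =
      2 * Real.cosh (r * u) / (2 * Real.cosh u) ^ r := by
  have h0 := Real.cosh_pos u
  rw [one_sub_halfLogistic, halfLogistic, Real.div_rpow (Real.exp_pos _).le (by positivity),
    Real.div_rpow (Real.exp_pos _).le (by positivity), ← Real.exp_mul, ← Real.exp_mul, ← add_div,
    Real.cosh_eq (r * u)]
  congr 1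
  rw [show -u * r = -(r * u) by ring, mul_comm u r]
  ring

/-- The powers of `2 * cosh u` contributed by the two factors of `R` combine to
`(2 * cosh u) ^ p`. -/
lemma recenterR_halfLogistic {p : ℝ} (hp : 1 < p) (u : ℝ) :
    recenterR p (halfLogistic u) = Real.exp (logR (p - 1) u) := by
  have hs : 0 < p - 1 := by linarith
  unfold recenterR
  set s := p - 1
  have h0 := Real.cosh_pos u
  have h1 := Real.cosh_pos (s * u)
  have h2 := Real.cosh_pos (u / s)
  rw [rpow_halfLogistic_add, rpow_halfLogistic_add, show 1 / s * u = u / s by ring,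
    Real.div_rpow (by positivity) (by positivity), ← Real.rpow_mul (by positivity),
    one_div_mul_cancel hs.ne', Real.rpow_one]
  rw [← Real.exp_log (show 0 < 2 * Real.cosh (s * u) / (2 * Real.cosh u) ^ s *
    ((2 * Real.cosh (u / s)) ^ s / (2 * Real.cosh u)) by positivity)]
  congr 1
  rw [Real.log_mul (by positivity) (by positivity), Real.log_div (by positivity) (by positivity),
    Real.log_div (by positivity) (by positivity), Real.log_rpow (by positivity),
    Real.log_rpow (by positivity), Real.log_mul (by positivity) (by positivity),
    Real.log_mul (by positivity) (by positivity), Real.log_mul (by positivity) (by positivity),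
    logR]
  ring

lemma recenterR_eq_exp {p b : ℝ} (hp : 1 < p) (hb : b ∈ Ioo (0 : ℝ) 1) :
    recenterR p b = Real.exp (logR (p - 1) (halfLogit b)) := by
  rw [← recenterR_halfLogistic hp, halfLogistic_halfLogit hb]

lemma recenterR_pos {p b : ℝ} (hp : 1 < p) (hb : b ∈ Ioo (0 : ℝ) 1) : 0 < recenterR p b := by
  rw [recenterR_eq_exp hp hb]; exact Real.exp_pos _

lemma hasDerivAt_log_cosh (u : ℝ) :
    HasDerivAt (fun u => Real.log (Real.cosh u)) (Real.tanh u) u := by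
  rw [Real.tanh_eq_sinh_div_cosh]
  exact (Real.hasDerivAt_cosh u).log (Real.cosh_pos u).ne'

lemma hasDerivAt_logR {s : ℝ} (hs : 0 < s) (u : ℝ) :
    HasDerivAt (logR s) (logRSlope s u) u := by
  have h1 : HasDerivAt (fun u => Real.log (Real.cosh (s * u))) (Real.tanh (s * u) * s) u :=
    (hasDerivAt_log_cosh (s * u)).comp u (by simpa using (hasDerivAt_id u).const_mul s)
  have h2 : HasDerivAt (fun u => Real.log (Real.cosh (u / s))) (Real.tanh (u / s) * (1 / s)) u :=
    (hasDerivAt_log_cosh (u / s)).comp (h := fun u => u / s) u ((hasDerivAt_id u).div_const s)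
  refine ((h1.add (h2.const_mul s)).sub ((hasDerivAt_log_cosh u).const_mul (s + 1))).congr_deriv ?_
  unfold logRSlope
  field_simp

lemma hasDerivAt_halfLogit {b : ℝ} (hb : b ∈ Ioo (0 : ℝ) 1) :
    HasDerivAt halfLogit (-(1 / (2 * b * (1 - b)))) b := by
  have h0 := hb.1
  have h1 : 0 < 1 - b := by linarith [hb.2]
  have := ((((hasDerivAt_id b).const_sub 1).div (hasDerivAt_id b) h0.ne').log
    (div_pos h1 h0).ne').div_const 2
  refine this.congr_deriv ?_
  simp only [id, Pi.div_apply]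
  field_simp
  ring

lemma hasDerivAt_recenterR {p b : ℝ} (hp : 1 < p) (hb : b ∈ Ioo (0 : ℝ) 1) :
    HasDerivAt (recenterR p)
      (-(recenterR p b / (2 * b * (1 - b))) * logRSlope (p - 1) (halfLogit b)) b := by
  have hs : 0 < p - 1 := by linarith
  have h := ((hasDerivAt_logR hs (halfLogit b)).comp b (hasDerivAt_halfLogit hb)).exp
  have h' := h.congr_of_eventuallyEq (f₁ := recenterR p) (by
    filter_upwards [isOpen_Ioo.mem_nhds hb] with x hx using recenterR_eq_exp hp hx)
  refine h'.congr_deriv ?_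
  rw [recenterR_eq_exp hp hb]
  simp only [Function.comp]
  ring

lemma deriv_recenterR_factor_pos {p b : ℝ} (hp : 1 < p) (hb : b ∈ Ioo (0 : ℝ) 1) :
    0 < recenterR p b / (2 * b * (1 - b)) := by
  have h0 := hb.1
  have h1 : 0 < 1 - b := by linarith [hb.2]
  have := recenterR_pos hp hb
  positivity

lemma deriv_recenterR_pos_iff {p b : ℝ} (hp : 1 < p) (hb : b ∈ Ioo (0 : ℝ) 1) :
    0 < deriv (recenterR p) b ↔ logRSlope (p - 1) (halfLogit b) < 0 := by
  have := deriv_recenterR_factor_pos hp hb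
  rw [(hasDerivAt_recenterR hp hb).deriv, neg_mul, Left.neg_pos_iff, mul_neg_iff]
  grind

lemma deriv_recenterR_neg_iff {p b : ℝ} (hp : 1 < p) (hb : b ∈ Ioo (0 : ℝ) 1) :
    deriv (recenterR p) b < 0 ↔ 0 < logRSlope (p - 1) (halfLogit b) := by
  have := deriv_recenterR_factor_pos hp hb
  rw [(hasDerivAt_recenterR hp hb).deriv, neg_mul, Left.neg_neg_iff, mul_pos_iff]
  grind

lemma mem_Ioo_one {b : ℝ} (hb : b ∈ Ioo (0 : ℝ) (1 / 2)) : b ∈ Ioo (0 : ℝ) 1 :=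
  ⟨hb.1, by linarith [hb.2]⟩

lemma exists_isRecenterPeak {p : ℝ} (hp : 1 < p) (hp2 : p ≠ 2) : ∃ b, IsRecenterPeak p b := by
  obtain ⟨v, hv, h1, h2⟩ := exists_logRSlope_sign (s := p - 1) (by linarith)
    (fun h => hp2 (by linarith))
  have hmem := halfLogistic_pos_lt_half hv
  refine ⟨halfLogistic v, hmem, fun x hx => ?_, fun x hx => ?_⟩
  · have hx1 : x ∈ Ioo (0 : ℝ) 1 := ⟨hx.1, hx.2.trans (halfLogistic_mem v).2⟩
    rw [deriv_recenterR_pos_iff hp hx1]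
    apply h2
    have := halfLogit_strictAntiOn hx1 (halfLogistic_mem v) hx.2
    rwa [halfLogit_halfLogistic] at this
  · have hx2 : x ∈ Ioo (0 : ℝ) (1 / 2) := ⟨hmem.1.trans hx.1, hx.2⟩
    have hx1 := mem_Ioo_one hx2
    rw [deriv_recenterR_neg_iff hp hx1]
    apply h1 _ (halfLogit_pos hx2)
    have := halfLogit_strictAntiOn (halfLogistic_mem v) hx1 hx.1
    rwa [halfLogit_halfLogistic] at this

lemma isRecenterPeak_unique {p b c : ℝ} (hb : IsRecenterPeak p b) (hc : IsRecenterPeak p c) :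
    b = c := by
  by_contra hne
  wlog h : b < c generalizing b c
  · exact this hc hb (Ne.symm hne) (lt_of_le_of_ne (not_lt.1 h) (Ne.symm hne))
  obtain ⟨x, h1, h2⟩ := exists_between h
  have := hb.2.2 x ⟨h1, h2.trans hc.1.2⟩
  have := hc.2.1 x ⟨hb.1.1.trans h1, h2⟩
  linarith

lemma recenterB_eq_of_isRecenterPeak {p b : ℝ} (hb : IsRecenterPeak p b) : recenterB p = b := by
  have : {b | IsRecenterPeak p b} = {b} :=
    Set.eq_singleton_iff_unique_mem.2 ⟨hb, fun c hc => isRecenterPeak_unique hc hb⟩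
  rw [recenterB, this, csSup_singleton]

lemma isRecenterPeak_recenterB {p : ℝ} (hp : 1 < p) (hp2 : p ≠ 2) :
    IsRecenterPeak p (recenterB p) := by
  obtain ⟨b, hb⟩ := exists_isRecenterPeak hp hp2
  rwa [recenterB_eq_of_isRecenterPeak hb]

lemma isRecenterPeak_iff {p : ℝ} (hp : 1 < p) (hp2 : p ≠ 2) (b : ℝ) :
    IsRecenterPeak p b ↔ b = recenterB p :=
  ⟨fun h => (recenterB_eq_of_isRecenterPeak h).symm, fun h => h ▸ isRecenterPeak_recenterB hp hp2⟩

lemma continuous_rpow_add {r : ℝ} (hr : 0 < r) :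
    Continuous fun b : ℝ => b ^ r + (1 - b) ^ r :=
  (Real.continuous_rpow_const hr.le).add
    ((Real.continuous_rpow_const hr.le).comp (continuous_const.sub continuous_id))

lemma continuous_recenterR {p : ℝ} (hp : 1 < p) : Continuous (recenterR p) := by
  have hs : 0 < p - 1 := by linarith
  exact (continuous_rpow_add hs).mul
    ((Real.continuous_rpow_const hs.le).comp (continuous_rpow_add (one_div_pos.2 hs)))

lemma strictMonoOn_recenterR {p : ℝ} (hp : 1 < p) (hp2 : p ≠ 2) :
    StrictMonoOn (recenterR p) (Icc 0 (recenterB p)) := by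
  apply strictMonoOn_of_deriv_pos (convex_Icc _ _) (continuous_recenterR hp).continuousOn
  rw [interior_Icc]
  exact (isRecenterPeak_recenterB hp hp2).2.1

lemma strictAntiOn_recenterR {p : ℝ} (hp : 1 < p) (hp2 : p ≠ 2) :
    StrictAntiOn (recenterR p) (Icc (recenterB p) (1 / 2)) := by
  apply strictAntiOn_of_deriv_neg (convex_Icc _ _) (continuous_recenterR hp).continuousOn
  rw [interior_Icc]
  exact (isRecenterPeak_recenterB hp hp2).2.2

lemma recenterR_lt_of_ne {p b : ℝ} (hp : 1 < p) (hp2 : p ≠ 2) (hb : b ∈ Icc (0 : ℝ) (1 / 2))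
    (hne : b ≠ recenterB p) : recenterR p b < recenterR p (recenterB p) := by
  have hB := (isRecenterPeak_recenterB hp hp2).1
  rcases lt_or_gt_of_ne hne with h | h
  · exact strictMonoOn_recenterR hp hp2 ⟨hb.1, h.le⟩ ⟨hB.1.le, le_rfl⟩ h
  · exact strictAntiOn_recenterR hp hp2 ⟨le_rfl, hB.2.le⟩ ⟨h.le, hb.2⟩ h

lemma recenterR_one_sub (p b : ℝ) : recenterR p (1 - b) = recenterR p b := by
  unfold recenterR
  rw [sub_sub_cancel, add_comm, add_comm ((1 - b) ^ (1 / (p - 1)))]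

lemma recenterR_le_recenterB {p b : ℝ} (hp : 1 < p) (hp2 : p ≠ 2) (hb : b ∈ Icc (0 : ℝ) 1) :
    recenterR p b ≤ recenterR p (recenterB p) := by
  wlog h : b ≤ 1 / 2 generalizing b
  · rw [← recenterR_one_sub]
    exact this ⟨by linarith [hb.2], by linarith [hb.1]⟩ (by linarith)
  by_cases hne : b = recenterB p
  · rw [hne]
  · exact (recenterR_lt_of_ne hp hp2 ⟨hb.1, h⟩ hne).le

lemma eq_or_eq_of_recenterR_eq {p b : ℝ} (hp : 1 < p) (hp2 : p ≠ 2) (hb : b ∈ Icc (0 : ℝ) 1)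
    (h : recenterR p b = recenterR p (recenterB p)) :
    b = recenterB p ∨ b = 1 - recenterB p := by
  by_contra! hne
  rcases le_total b (1 / 2) with h2 | h2
  · exact (recenterR_lt_of_ne hp hp2 ⟨hb.1, h2⟩ hne.1).ne h
  · refine (recenterR_lt_of_ne hp hp2 (b := 1 - b) ⟨by linarith [hb.2], by linarith⟩ ?_).ne
      ((recenterR_one_sub p b).trans h)
    intro h3
    exact hne.2 (by linarith)

lemma recenterR_zero {p : ℝ} (hp : 1 < p) : recenterR p 0 = 1 := by
  have hs : 0 < p - 1 := by linarith
  simp [recenterR, Real.zero_rpow hs.ne', Real.zero_rpow (inv_pos.2 hs).ne']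

lemma one_lt_recenterR_recenterB {p : ℝ} (hp : 1 < p) (hp2 : p ≠ 2) :
    1 < recenterR p (recenterB p) := by
  have hB := (isRecenterPeak_recenterB hp hp2).1
  rw [← recenterR_zero hp]
  exact recenterR_lt_of_ne hp hp2 (by norm_num) hB.1.ne

lemma recenterR_two (b : ℝ) : recenterR 2 b = 1 := by
  norm_num [recenterR]

/-! ### Two-point distributions -/

/-- The tangent line to `|·|^p` at a point `y > 0` touches the graph only there. -/
lemma tangent_lt_abs_rpow {p y x : ℝ} (hp : 1 < p) (hy : 0 < y) (hxy : x ≠ y) :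
    y ^ p + p * y ^ (p - 1) * (x - y) < |x| ^ p := by
  obtain ⟨z, rfl⟩ : ∃ z, x = y * (1 + z) := ⟨x / y - 1, by field_simp; ring⟩
  have hz : z ≠ 0 := by rintro rfl; simp at hxy
  have hyp : 0 < y ^ p := Real.rpow_pos_of_pos hy p
  have key : 1 + p * z < |1 + z| ^ p := by
    rcases le_or_gt (-1) z with h | h
    · rw [abs_of_nonneg (by linarith)]
      exact one_add_mul_self_lt_rpow_one_add h hz hp
    · have := Real.rpow_nonneg (abs_nonneg (1 + z)) p
      nlinarith
  rw [abs_mul, abs_of_pos hy, Real.mul_rpow hy.le (abs_nonneg _), Real.rpow_sub_one hy.ne']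
  have := mul_lt_mul_of_pos_left key hyp
  calc y ^ p + p * (y ^ p / y) * (y * (1 + z) - y) = y ^ p * (1 + p * z) := by field_simp; ring
    _ < _ := this

/-- The denominator `b^{1/(p-1)} + (1-b)^{1/(p-1)}` in `t_b`, which is also the base of the second
factor of `R(p, b)`. -/
noncomputable def conjSum (p b : ℝ) : ℝ := b ^ (1 / (p - 1)) + (1 - b) ^ (1 / (p - 1))

lemma conjSum_pos {p b : ℝ} (hb : b ∈ Ioo (0 : ℝ) 1) : 0 < conjSum p b := by
  have h1 : 0 < 1 - b := by linarith [hb.2]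
  have := Real.rpow_pos_of_pos hb.1 (1 / (p - 1))
  have := Real.rpow_pos_of_pos h1 (1 / (p - 1))
  unfold conjSum; linarith

lemma conjSum_one_sub (p b : ℝ) : conjSum p (1 - b) = conjSum p b := by
  simp only [conjSum, sub_sub_cancel, add_comm]

lemma recenterT_one_sub {p b : ℝ} (hb : b ∈ Ioo (0 : ℝ) 1) :
    recenterT p (1 - b) = -recenterT p b := by
  have h := conjSum_pos (p := p) hb
  have h' := conjSum_one_sub p b
  unfold recenterT
  rw [← conjSum, ← conjSum, h']
  field_simp
  rw [conjSum]
  ring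

lemma sub_recenterT (p b : ℝ) : b - recenterT p b = b ^ (1 / (p - 1)) / conjSum p b := by
  rw [recenterT, ← conjSum]; ring

lemma one_sub_add_recenterT {p b : ℝ} (hb : b ∈ Ioo (0 : ℝ) 1) :
    1 - b + recenterT p b = (1 - b) ^ (1 / (p - 1)) / conjSum p b := by
  rw [← conjSum_one_sub, ← sub_recenterT, recenterT_one_sub hb]
  ring

lemma optimal_rpow {p b : ℝ} (hp : 1 < p) (hb : 0 < b) {S : ℝ} (hS : 0 < S) :
    (b ^ (1 / (p - 1)) / S) ^ (p - 1) = b / S ^ (p - 1) := by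
  have hs : 0 < p - 1 := by linarith
  rw [Real.div_rpow (by positivity) hS.le, ← Real.rpow_mul hb.le, one_div_mul_cancel hs.ne',
    Real.rpow_one]

/-- The minimum over `t` of the `p`-th absolute moment of `X_{1-b,b} - t`, attained at `t_b` only:
the tangent lines to `|·|^p` at `b - t_b` and at `1 - b + t_b` have slopes that cancel. -/
lemma weighted_moment_min {p b : ℝ} (hp : 1 < p) (hb : b ∈ Ioo (0 : ℝ) 1) :
    ((1 - b) * |b - recenterT p b| ^ p + b * |-(1 - b) - recenterT p b| ^ p =
      b * (1 - b) / conjSum p b ^ (p - 1)) ∧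
    ∀ t, t ≠ recenterT p b →
      b * (1 - b) / conjSum p b ^ (p - 1) < (1 - b) * |b - t| ^ p + b * |-(1 - b) - t| ^ p := by
  have hS := conjSum_pos (p := p) hb
  have h0 := hb.1
  have h1 : 0 < 1 - b := by linarith [hb.2]
  set τ := recenterT p b with hτ
  have e1 := sub_recenterT p b
  have e2 := one_sub_add_recenterT (p := p) hb
  rw [← hτ] at e1 e2
  have y1 : 0 < b - τ := by rw [e1]; positivity
  have y2 : 0 < 1 - b + τ := by rw [e2]; positivity
  have k1 : (b - τ) ^ (p - 1) = b / conjSum p b ^ (p - 1) := by rw [e1, optimal_rpow hp h0 hS]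
  have k2 : (1 - b + τ) ^ (p - 1) = (1 - b) / conjSum p b ^ (p - 1) := by
    rw [e2, optimal_rpow hp h1 hS]
  have m1 : (b - τ) ^ p = b / conjSum p b ^ (p - 1) * (b - τ) := by
    rw [← k1, ← Real.rpow_add_one y1.ne', sub_add_cancel]
  have m2 : (1 - b + τ) ^ p = (1 - b) / conjSum p b ^ (p - 1) * (1 - b + τ) := by
    rw [← k2, ← Real.rpow_add_one y2.ne', sub_add_cancel]
  have n : ∀ t, |-(1 - b) - t| = |1 - b + t| := fun t => by rw [← abs_neg]; congr 1; ring
  constructor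
  · rw [n, abs_of_pos y1, abs_of_pos y2, m1, m2]
    ring
  · intro t ht
    have a1 := tangent_lt_abs_rpow (x := b - t) hp y1 (fun h => ht (by linarith))
    have a2 := tangent_lt_abs_rpow (x := 1 - b + t) hp y2 (fun h => ht (by linarith))
    rw [n]
    rw [k1, m1] at a1
    rw [k2, m2] at a2
    have := add_lt_add (mul_lt_mul_of_pos_left a1 h1) (mul_lt_mul_of_pos_left a2 h0)
    refine lt_of_eq_of_lt ?_ this
    ring

lemma weighted_moment_eq {p b : ℝ} (hb : b ∈ Ioo (0 : ℝ) 1) :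
    (1 - b) * |b| ^ p + b * |-(1 - b)| ^ p =
      recenterR p b * (b * (1 - b) / conjSum p b ^ (p - 1)) := by
  have hS := conjSum_pos (p := p) hb
  have h0 := hb.1
  have h1 : 0 < 1 - b := by linarith [hb.2]
  have : 0 < conjSum p b ^ (p - 1) := by positivity
  rw [abs_neg, abs_of_pos h0, abs_of_pos h1, recenterR, ← conjSum, Real.rpow_sub_one h0.ne',
    Real.rpow_sub_one h1.ne']
  field_simp

/-- The two-point case of the inequality, with its case of equality; both sides are homogeneous in
`(a, b, t)`, which reduces it to `a + b = 1`. -/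
lemma twoPoint_bound {p a b : ℝ} (hp : 1 < p) (ha : 0 < a) (hb : 0 < b) (t : ℝ) :
    0 < a * |b - t| ^ p + b * |-a - t| ^ p ∧
    a * |b| ^ p + b * |-a| ^ p ≤
      recenterR p (b / (a + b)) * (a * |b - t| ^ p + b * |-a - t| ^ p) ∧
    (a * |b| ^ p + b * |-a| ^ p =
      recenterR p (b / (a + b)) * (a * |b - t| ^ p + b * |-a - t| ^ p) ↔
      t = (a + b) * recenterT p (b / (a + b))) := by
  obtain ⟨m, β, τ, hm, hβ, rfl, rfl, rfl⟩ : ∃ m β τ : ℝ, 0 < m ∧ β ∈ Ioo (0 : ℝ) 1 ∧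
      a = m * (1 - β) ∧ b = m * β ∧ t = m * τ := by
    refine ⟨a + b, b / (a + b), t / (a + b), by positivity, ⟨by positivity, ?_⟩, ?_, ?_, ?_⟩
    · rw [div_lt_one (by positivity)]; linarith
    · field_simp; ring
    all_goals field_simp
  have hab : m * (1 - β) + m * β = m := by ring
  have hβ' : m * β / m = β := by field_simp
  rw [hab, hβ']
  have hmp : 0 < m ^ p := by positivity
  have sc : ∀ x, |m * x| ^ p = m ^ p * |x| ^ p := fun x => by
    rw [abs_mul, abs_of_pos hm, Real.mul_rpow hm.le (abs_nonneg x)]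
  rw [show m * β - m * τ = m * (β - τ) by ring,
    show -(m * (1 - β)) - m * τ = m * (-(1 - β) - τ) by ring,
    show -(m * (1 - β)) = m * (-(1 - β)) by ring, sc, sc, sc, sc]
  have hnum := weighted_moment_eq (p := p) hβ
  have hR := recenterR_pos hp hβ
  obtain ⟨h1, h2⟩ := weighted_moment_min hp hβ
  have hS := conjSum_pos (p := p) hβ
  have hβ0 := hβ.1
  have hβ1 : 0 < 1 - β := by linarith [hβ.2]
  set V := β * (1 - β) / conjSum p β ^ (p - 1) with hV
  have hVpos : 0 < V := by positivity
  set W := (1 - β) * |β - τ| ^ p + β * |-(1 - β) - τ| ^ p with hW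
  have hden : m * (1 - β) * (m ^ p * |β - τ| ^ p) + m * β * (m ^ p * |-(1 - β) - τ| ^ p)
      = m * m ^ p * W := by rw [hW]; ring
  have hnum' : m * (1 - β) * (m ^ p * |β| ^ p) + m * β * (m ^ p * |-(1 - β)| ^ p)
      = m * m ^ p * (recenterR p β * V) := by rw [← hnum]; ring
  rw [hden, hnum']
  have hmm : 0 < m * m ^ p := by positivity
  by_cases hτ : τ = recenterT p β
  · have hWV : W = V := by rw [hW, hτ, h1]
    rw [hWV, hτ]
    refine ⟨by positivity, le_of_eq (by ring), ?_⟩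
    simp only [iff_true]
    ring
  · have hWV := h2 τ hτ
    rw [← hW] at hWV
    have h3 : m * m ^ p * (recenterR p β * V) < recenterR p β * (m * m ^ p * W) := by
      have := mul_lt_mul_of_pos_left hWV (mul_pos hmm hR)
      linarith
    refine ⟨mul_pos hmm (hVpos.trans hWV), h3.le, ⟨fun h => absurd h h3.ne, fun h => ?_⟩⟩
    exact absurd (mul_left_cancel₀ hm.ne' h) hτ

lemma div_add_mem_Ioo {a b : ℝ} (ha : 0 < a) (hb : 0 < b) : b / (a + b) ∈ Ioo (0 : ℝ) 1 :=
  ⟨by positivity, by rw [div_lt_one (by positivity)]; linarith⟩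

lemma recenterConst_eq_of_isMax {p β : ℝ} (hp : 1 < p) (hβ : β ∈ Ioo (0 : ℝ) 1)
    (hmax : ∀ b ∈ Ioo (0 : ℝ) 1, recenterR p b ≤ recenterR p β) :
    recenterConst (fun x => |x| ^ p) = ENNReal.ofReal (recenterR p β) := by
  have hβ0 := hβ.1
  have hβ1 : 0 < 1 - β := by linarith [hβ.2]
  apply le_antisymm
  · refine iSup_le fun a => iSup_le fun b => iSup_le fun t => iSup_le fun ha => iSup_le fun hb => ?_
    apply ENNReal.ofReal_le_ofReal
    obtain ⟨h1, h2, -⟩ := twoPoint_bound hp ha hb t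
    rw [div_le_iff₀ h1]
    exact h2.trans (mul_le_mul_of_nonneg_right (hmax _ (div_add_mem_Ioo ha hb)) h1.le)
  · refine le_iSup_of_le (1 - β) (le_iSup_of_le β (le_iSup_of_le (recenterT p β)
      (le_iSup_of_le hβ1 (le_iSup_of_le hβ0 ?_))))
    apply ENNReal.ofReal_le_ofReal
    obtain ⟨h1, -, h3⟩ := twoPoint_bound hp hβ1 hβ0 (recenterT p β)
    simp only [sub_add_cancel, div_one, one_mul, iff_true] at h3
    rw [le_div_iff₀ h1, h3]

lemma exists_isMax {p : ℝ} (hp : 1 < p) : ∃ β ∈ Ioo (0 : ℝ) (1 / 2),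
    (∀ b ∈ Icc (0 : ℝ) 1, recenterR p b ≤ recenterR p β) ∧ (p ≠ 2 → β = recenterB p) := by
  by_cases hp2 : p = 2
  · subst hp2
    exact ⟨1 / 4, by norm_num, fun b _ => by rw [recenterR_two, recenterR_two], by simp⟩
  · exact ⟨recenterB p, (isRecenterPeak_recenterB hp hp2).1,
      fun b hb => recenterR_le_recenterB hp hp2 hb, fun _ => rfl⟩

lemma recenterC_eq_of_isMax {p β : ℝ} (hp : 1 < p) (hβ : β ∈ Ioo (0 : ℝ) 1)
    (hmax : ∀ b ∈ Icc (0 : ℝ) 1, recenterR p b ≤ recenterR p β) :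
    recenterC p = recenterR p β := by
  rw [recenterC, recenterConst_eq_of_isMax hp hβ fun b hb => hmax b (Ioo_subset_Icc_self hb),
    ENNReal.toReal_ofReal (recenterR_pos hp hβ).le]

lemma exists_recenterC_eq {p : ℝ} (hp : 1 < p) :
    ∃ β ∈ Ioo (0 : ℝ) (1 / 2), recenterC p = recenterR p β := by
  obtain ⟨β, hβ, hmax, -⟩ := exists_isMax hp
  exact ⟨β, hβ, recenterC_eq_of_isMax hp (mem_Ioo_one hβ) hmax⟩

lemma recenterR_le_recenterC {p b : ℝ} (hp : 1 < p) (hb : b ∈ Icc (0 : ℝ) 1) :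
    recenterR p b ≤ recenterC p := by
  obtain ⟨β, hβ, hmax, -⟩ := exists_isMax hp
  rw [recenterC_eq_of_isMax hp (mem_Ioo_one hβ) hmax]
  exact hmax b hb

lemma recenterC_eq {p : ℝ} (hp : 1 < p) (hp2 : p ≠ 2) :
    recenterC p = recenterR p (recenterB p) :=
  recenterC_eq_of_isMax hp (mem_Ioo_one (isRecenterPeak_recenterB hp hp2).1)
    fun _ hb => recenterR_le_recenterB hp hp2 hb

lemma recenterC_two : recenterC 2 = 1 := by
  obtain ⟨β, -, h⟩ := exists_recenterC_eq (p := 2) (by norm_num)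
  rw [h, recenterR_two]

lemma recenterC_pos {p : ℝ} (hp : 1 < p) : 0 < recenterC p := by
  obtain ⟨β, hβ, h⟩ := exists_recenterC_eq hp
  rw [h]
  exact recenterR_pos hp (mem_Ioo_one hβ)

lemma recenterConst_eq {p : ℝ} (hp : 1 < p) :
    recenterConst (fun x => |x| ^ p) = ENNReal.ofReal (recenterC p) := by
  obtain ⟨β, hβ, hmax, -⟩ := exists_isMax hp
  rw [recenterC_eq_of_isMax hp (mem_Ioo_one hβ) hmax]
  exact recenterConst_eq_of_isMax hp (mem_Ioo_one hβ)
    fun b hb => hmax b (Ioo_subset_Icc_self hb)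

lemma isLUB_recenterC {p : ℝ} (hp : 1 < p) : IsLUB (recenterR p '' Icc 0 1) (recenterC p) := by
  obtain ⟨β, hβ, h⟩ := exists_recenterC_eq hp
  refine IsGreatest.isLUB ⟨⟨β, Ioo_subset_Icc_self (mem_Ioo_one hβ), h.symm⟩, ?_⟩
  rintro _ ⟨b, hb, rfl⟩
  exact recenterR_le_recenterC hp hb

lemma isGreatest_recenterC {p : ℝ} (hp : 1 < p) :
    IsGreatest (recenterR p '' Ioo 0 (1 / 2)) (recenterC p) := by
  obtain ⟨β, hβ, h⟩ := exists_recenterC_eq hp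
  refine ⟨⟨β, hβ, h.symm⟩, ?_⟩
  rintro _ ⟨b, hb, rfl⟩
  exact recenterR_le_recenterC hp (Ioo_subset_Icc_self (mem_Ioo_one hb))

lemma recenterT_ne_zero {p b : ℝ} (hp : 1 < p) (hp2 : p ≠ 2) (hb : b ∈ Ioo (0 : ℝ) (1 / 2)) :
    recenterT p b ≠ 0 := by
  intro h
  have hs : 0 < p - 1 := by linarith
  have hb1 := mem_Ioo_one hb
  have h0 := hb.1
  have h1 : 0 < 1 - b := by linarith [hb1.2]
  have hS := conjSum_pos (p := p) hb1
  have e1 := sub_recenterT p b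
  have e2 := one_sub_add_recenterT (p := p) hb1
  rw [h, sub_zero, eq_div_iff hS.ne'] at e1
  rw [h, add_zero, eq_div_iff hS.ne'] at e2
  -- the odds `x = b / (1 - b)` satisfy `x ^ (1 / (p - 1)) = x`
  have e3 : (b / (1 - b)) ^ (1 / (p - 1)) = (b / (1 - b)) ^ (1 : ℝ) := by
    rw [Real.div_rpow h0.le h1.le, ← e1, ← e2, Real.rpow_one]
    field_simp
  have hx0 : 0 < b / (1 - b) := by positivity
  have hx1 : b / (1 - b) ≠ 1 := by
    rw [Ne, div_eq_one_iff_eq h1.ne']; intro h; linarith [hb.2]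
  have := (Real.rpow_right_inj hx0 hx1).1 e3
  rw [div_eq_one_iff_eq hs.ne'] at this
  exact hp2 (by linarith)

/-! ### General distributions and the cases of equality -/

/-- If every chord of `g` over an interval around `0` passes at or below the origin, then `g` lies
below some line through the origin; its slope separates the values `g b / b` from the values
`-g (-a) / a`. -/
lemma exists_line_above {g : ℝ → ℝ} (h0 : g 0 ≤ 0)
    (h : ∀ a b : ℝ, 0 < a → 0 < b → a * g b + b * g (-a) ≤ 0) :
    ∃ l : ℝ, ∀ y, g y ≤ l * y := by
  set S := (fun b => g b / b) '' Ioi 0 with hS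
  have hne : S.Nonempty := ⟨_, 1, by simp, rfl⟩
  have hup : ∀ a, 0 < a → ∀ x ∈ S, x ≤ -g (-a) / a := by
    rintro a ha _ ⟨b, hb, rfl⟩
    have hb : 0 < b := hb
    simp only
    rw [div_le_div_iff₀ hb ha]
    linarith [h a b ha hb]
  refine ⟨sSup S, fun y => ?_⟩
  rcases lt_trichotomy y 0 with hy | rfl | hy
  · have h1 := csSup_le hne (hup (-y) (by linarith))
    rw [neg_neg, div_neg, neg_div, neg_neg, le_div_iff_of_neg hy] at h1
    exact h1
  · simpa using h0
  · have h1 : g y / y ≤ sSup S := le_csSup ⟨_, hup 1 one_pos⟩ ⟨y, hy, rfl⟩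
    rwa [div_le_iff₀ hy] at h1

lemma exists_line {p : ℝ} (hp : 1 < p) (t : ℝ) :
    ∃ l : ℝ, ∀ y : ℝ, |y| ^ p - recenterC p * |y - t| ^ p ≤ l * y := by
  apply exists_line_above
  · have := Real.rpow_nonneg (abs_nonneg (0 - t)) p
    have := mul_nonneg (recenterC_pos hp).le this
    rw [abs_zero, Real.zero_rpow (by linarith)]
    linarith
  · intro a b ha hb
    obtain ⟨h1, h2, -⟩ := twoPoint_bound hp ha hb t
    have := recenterR_le_recenterC hp (Ioo_subset_Icc_self (div_add_mem_Ioo ha hb))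
    have := mul_le_mul_of_nonneg_right this h1.le
    linarith

lemma ofReal_abs_rpow {p : ℝ} (hp : 1 < p) (x : ℝ) :
    ENNReal.ofReal (|x| ^ p) = ‖x‖ₑ ^ p := by
  rw [← ENNReal.ofReal_rpow_of_nonneg (abs_nonneg x) (by linarith), ← Real.enorm_eq_ofReal_abs]

section
variable {Ω : Type u} [MeasurableSpace Ω] {P : Measure Ω} {X : Ω → ℝ} {p : ℝ}

lemma absMoment_lt_top_iff (hp : 1 < p) (hX : AEStronglyMeasurable X P) :
    absMoment P p X < ∞ ↔ MemLp X (ENNReal.ofReal p) P := by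
  have h0 : ENNReal.ofReal p ≠ 0 := by simp; linarith
  rw [MemLp, and_iff_right hX,
    eLpNorm_lt_top_iff_lintegral_rpow_enorm_lt_top h0 ENNReal.ofReal_ne_top,
    ENNReal.toReal_ofReal (by linarith)]
  simp only [absMoment, ofReal_abs_rpow hp]

lemma integrable_abs_rpow (hp : 1 < p) (hX : AEStronglyMeasurable X P)
    (h : absMoment P p X < ∞) : Integrable (fun ω => |X ω| ^ p) P := by
  have := ((absMoment_lt_top_iff hp hX).1 h).integrable_norm_rpow (by simp; linarith)
    ENNReal.ofReal_ne_top
  simpa [ENNReal.toReal_ofReal (by linarith : 0 ≤ p)] using this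

lemma absMoment_eq_ofReal (hp : 1 < p) (hX : AEStronglyMeasurable X P)
    (h : absMoment P p X < ∞) : absMoment P p X = ENNReal.ofReal (∫ ω, |X ω| ^ p ∂P) := by
  rw [ofReal_integral_eq_lintegral_ofReal (integrable_abs_rpow hp hX h)
    (ae_of_all _ fun ω => Real.rpow_nonneg (abs_nonneg _) p), absMoment]

variable [IsProbabilityMeasure P]

lemma absMoment_sub_const_lt_top_iff (hp : 1 < p) (hX : AEStronglyMeasurable X P) (c : ℝ) :
    absMoment P p (fun ω => X ω - c) < ∞ ↔ absMoment P p X < ∞ := by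
  rw [absMoment_lt_top_iff hp hX,
    absMoment_lt_top_iff (X := fun ω => X ω - c) hp (hX.sub aestronglyMeasurable_const)]
  constructor
  · intro h
    have := h.add (memLp_const (μ := P) (p := ENNReal.ofReal p) c)
    refine this.ae_eq (ae_of_all _ fun ω => ?_)
    simp
  · exact fun h => h.sub (memLp_const c)

/-- The inequality `E|X - EX|^p ≤ C_p E|X|^p` for a finite `p`-th moment. In the case of
equality `X - EX` is carried by the set where the line supporting
`|y|^p - C_p |y + EX|^p` touches it. -/
lemma centered_le_of_lt_top (hp : 1 < p) (hX : Integrable X P) (h : absMoment P p X < ∞) :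
    absMoment P p (fun ω => X ω - ∫ ω', X ω' ∂P) ≤
        ENNReal.ofReal (recenterC p) * absMoment P p X ∧
    (absMoment P p (fun ω => X ω - ∫ ω', X ω' ∂P) =
        ENNReal.ofReal (recenterC p) * absMoment P p X →
      ∃ l : ℝ, (∀ y : ℝ, |y| ^ p - recenterC p * |y + ∫ ω, X ω ∂P| ^ p ≤ l * y) ∧
        ∀ᵐ ω ∂P, |X ω - ∫ ω, X ω ∂P| ^ p - recenterC p * |X ω| ^ p =
          l * (X ω - ∫ ω, X ω ∂P)) := by
  set m := ∫ ω, X ω ∂P with hm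
  have hC := recenterC_pos hp
  have hXm := hX.aestronglyMeasurable
  have hYm : AEStronglyMeasurable (fun ω => X ω - m) P := hXm.sub aestronglyMeasurable_const
  have hY := (absMoment_sub_const_lt_top_iff hp hXm m).2 h
  obtain ⟨l, hl⟩ := exists_line hp (-m)
  simp only [sub_neg_eq_add] at hl
  have i1 := integrable_abs_rpow hp hXm h
  have i2 := integrable_abs_rpow hp hYm hY
  have i3 : Integrable (fun ω => l * (X ω - m)) P := (hX.sub (integrable_const m)).const_mul l
  have e3 : ∫ ω, l * (X ω - m) ∂P = 0 := by
    rw [integral_const_mul, integral_sub hX (integrable_const m)]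
    simp [← hm]
  let G : Ω → ℝ := fun ω => l * (X ω - m) - (|X ω - m| ^ p - recenterC p * |X ω| ^ p)
  have hG : ∀ ω, 0 ≤ G ω := fun ω => by
    have := hl (X ω - m)
    rw [sub_add_cancel] at this
    simp only [G]; linarith
  have i4 : Integrable (fun ω => |X ω - m| ^ p - recenterC p * |X ω| ^ p) P :=
    i2.sub (i1.const_mul _)
  have iG : Integrable G P := i3.sub i4
  have eG : ∫ ω, G ω ∂P =
      recenterC p * ∫ ω, |X ω| ^ p ∂P - ∫ ω, |X ω - m| ^ p ∂P := by
    simp only [G]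
    rw [integral_sub i3 i4, e3, integral_sub i2 (i1.const_mul _),
      integral_const_mul]
    ring
  have nonneg1 : 0 ≤ ∫ ω, |X ω| ^ p ∂P :=
    integral_nonneg fun ω => Real.rpow_nonneg (abs_nonneg _) p
  have nonneg2 : 0 ≤ ∫ ω, |X ω - m| ^ p ∂P :=
    integral_nonneg fun ω => Real.rpow_nonneg (abs_nonneg _) p
  rw [absMoment_eq_ofReal hp hXm h, absMoment_eq_ofReal hp hYm hY, ← ENNReal.ofReal_mul hC.le]
  constructor
  · apply ENNReal.ofReal_le_ofReal
    have : 0 ≤ ∫ ω, G ω ∂P := integral_nonneg hG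
    linarith
  · intro heq
    rw [ENNReal.ofReal_eq_ofReal_iff nonneg2 (by positivity)] at heq
    refine ⟨l, hl, ?_⟩
    have h0 : ∫ ω, G ω ∂P = 0 := by rw [eG, heq, sub_self]
    rw [integral_eq_zero_iff_of_nonneg hG iG] at h0
    filter_upwards [h0] with ω hω
    simp only [G, Pi.zero_apply] at hω
    linarith

lemma centered_eq_of_eq_top (hp : 1 < p) (hX : Integrable X P) (h : absMoment P p X = ∞) :
    absMoment P p (fun ω => X ω - ∫ ω', X ω' ∂P) =
      ENNReal.ofReal (recenterC p) * absMoment P p X := by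
  have h1 : ¬ absMoment P p (fun ω => X ω - ∫ ω', X ω' ∂P) < ∞ := by
    rw [absMoment_sub_const_lt_top_iff hp hX.aestronglyMeasurable]
    simp [h]
  rw [h, ENNReal.mul_top (by simpa using recenterC_pos hp)]
  simpa using h1

lemma centered_le (hp : 1 < p) (hX : Integrable X P) :
    absMoment P p (fun ω => X ω - ∫ ω', X ω' ∂P) ≤
      ENNReal.ofReal (recenterC p) * absMoment P p X := by
  by_cases h : absMoment P p X = ∞
  · exact (centered_eq_of_eq_top hp hX h).le
  · exact (centered_le_of_lt_top hp hX (lt_top_iff_ne_top.2 h)).1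

/-- A zero-mean random variable with two values of opposite signs has the law `twoPointLaw`. -/
lemma map_eq_twoPointLaw {Y : Ω → ℝ} (hY : Integrable Y P) (h0 : ∫ ω, Y ω ∂P = 0) {a b : ℝ}
    (ha : 0 < a) (hb : 0 < b) (h : ∀ᵐ ω ∂P, Y ω = -a ∨ Y ω = b) :
    P.map Y = twoPointLaw a b := by
  have hYm := hY.aemeasurable
  have : IsProbabilityMeasure (P.map Y) := Measure.isProbabilityMeasure_map hYm
  set μ := P.map Y with hμ
  have hsupp : ∀ᵐ y ∂μ, y ∈ ({-a} ∪ {b} : Set ℝ) := by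
    refine (ae_map_iff (p := (· ∈ ({-a} ∪ {b} : Set ℝ))) hYm
      ((measurableSet_singleton _).union (measurableSet_singleton _))).2 ?_
    simpa [or_comm] using h
  have hne : -a ≠ b := by linarith
  have hμe : μ = μ {-a} • Measure.dirac (-a) + μ {b} • Measure.dirac b := by
    rw [← Measure.restrict_singleton, ← Measure.restrict_singleton,
      ← Measure.restrict_union (by simpa using hne) (measurableSet_singleton b),
      Measure.restrict_eq_self_of_ae_mem hsupp]
  have hmean : ∫ y, y ∂μ = 0 := by
    exact (integral_map hYm aestronglyMeasurable_id).trans h0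
  have hf1 : μ {-a} ≠ ∞ := measure_ne_top _ _
  have hf2 : μ {b} ≠ ∞ := measure_ne_top _ _
  have hint : ∀ (c : ℝ≥0∞) (x : ℝ), c ≠ ∞ → Integrable (fun y : ℝ => y) (c • Measure.dirac x) :=
    fun c x hc => (integrable_dirac (by simp)).smul_measure hc
  set α := (μ {-a}).toReal with hα
  set γ := (μ {b}).toReal with hγ
  have s1 : α + γ = 1 := by
    have := congrArg (fun ν : Measure ℝ => (ν univ).toReal) hμe
    simp only [Measure.coe_add, Pi.add_apply, Measure.smul_apply, measure_univ, smul_eq_mul,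
      mul_one, ENNReal.toReal_add hf1 hf2, ENNReal.toReal_one] at this
    exact this.symm
  have s2 : α * (-a) + γ * b = 0 := by
    rw [hμe, integral_add_measure (hint _ _ hf1) (hint _ _ hf2), integral_smul_measure,
      integral_smul_measure, integral_dirac, integral_dirac] at hmean
    exact hmean
  have hα' : α = b / (a + b) := by
    rw [eq_div_iff (by positivity)]; linear_combination b * s1 - s2
  have hγ' : γ = a / (a + b) := by
    rw [eq_div_iff (by positivity)]; linear_combination a * s1 + s2
  rw [hμe, twoPointLaw, ← hα', ← hγ', hα, hγ, ENNReal.ofReal_toReal hf1,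
    ENNReal.ofReal_toReal hf2]

end

lemma twoPointLaw_map {a b : ℝ} {f : ℝ → ℝ} (hf : Measurable f) :
    (twoPointLaw a b).map f =
      ENNReal.ofReal (b / (a + b)) • Measure.dirac (f (-a)) +
        ENNReal.ofReal (a / (a + b)) • Measure.dirac (f b) := by
  rw [twoPointLaw, Measure.map_add _ _ hf, Measure.map_smul, Measure.map_smul,
    Measure.map_dirac' hf, Measure.map_dirac' hf]

lemma twoPointLaw_map_unit (β τ l : ℝ) :
    (twoPointLaw (1 - β) β).map (fun x => l * (x - τ)) =
      ENNReal.ofReal β • Measure.dirac (l * (-(1 - β) - τ)) +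
        ENNReal.ofReal (1 - β) • Measure.dirac (l * (β - τ)) := by
  rw [twoPointLaw_map (by fun_prop)]
  simp

section
variable {Ω : Type u} [MeasurableSpace Ω] {P : Measure Ω} {X : Ω → ℝ} {p : ℝ}

lemma absMoment_sub_of_map {β τ l : ℝ} (hβ : β ∈ Ioo (0 : ℝ) 1) (hXm : AEMeasurable X P)
    (h : P.map X = (twoPointLaw (1 - β) β).map (fun x => l * (x - τ))) (c : ℝ) :
    absMoment P p (fun ω => X ω - c) =
      ENNReal.ofReal (β * |l * (-(1 - β) - τ) - c| ^ p + (1 - β) * |l * (β - τ) - c| ^ p) := by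
  have h1 : 0 < 1 - β := by linarith [hβ.2]
  have hn : ∀ x : ℝ, 0 ≤ |x| ^ p := fun x => Real.rpow_nonneg (abs_nonneg _) p
  have hmeas : Measurable fun x : ℝ => ENNReal.ofReal (|x - c| ^ p) := by fun_prop
  have : absMoment P p (fun ω => X ω - c) = ∫⁻ x, ENNReal.ofReal (|x - c| ^ p) ∂(P.map X) := by
    rw [lintegral_map' hmeas.aemeasurable hXm, absMoment]
  rw [this, h, twoPointLaw_map_unit, lintegral_add_measure, lintegral_smul_measure,
    lintegral_smul_measure, lintegral_dirac, lintegral_dirac, smul_eq_mul, smul_eq_mul,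
    ← ENNReal.ofReal_mul hβ.1.le, ← ENNReal.ofReal_mul h1.le,
    ← ENNReal.ofReal_add (mul_nonneg hβ.1.le (hn _)) (mul_nonneg h1.le (hn _))]

lemma integral_of_map {β τ l : ℝ} (hβ : β ∈ Ioo (0 : ℝ) 1) (hXm : AEMeasurable X P)
    (h : P.map X = (twoPointLaw (1 - β) β).map (fun x => l * (x - τ))) :
    ∫ ω, X ω ∂P = -l * τ := by
  have h1 : 0 < 1 - β := by linarith [hβ.2]
  have : ∫ ω, X ω ∂P = ∫ x, x ∂(P.map X) := (integral_map hXm aestronglyMeasurable_id).symm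
  have hint : ∀ (c x : ℝ), Integrable (fun y : ℝ => y) (ENNReal.ofReal c • Measure.dirac x) :=
    fun c x => (integrable_dirac (by simp)).smul_measure ENNReal.ofReal_ne_top
  rw [this, h, twoPointLaw_map_unit, integral_add_measure (hint _ _) (hint _ _),
    integral_smul_measure, integral_smul_measure, integral_dirac, integral_dirac,
    ENNReal.toReal_ofReal hβ.1.le, ENNReal.toReal_ofReal h1.le, smul_eq_mul, smul_eq_mul]
  ring

/-- The extremal two-point laws: for these the ratio of the two moments is `R(p, β)`. -/
lemma centered_eq_of_map {β l : ℝ} (hp : 1 < p) (hβ : β ∈ Ioo (0 : ℝ) 1) (hXm : AEMeasurable X P)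
    (h : P.map X = (twoPointLaw (1 - β) β).map (fun x => l * (x - recenterT p β))) :
    absMoment P p (fun ω => X ω - ∫ ω', X ω' ∂P) =
      ENNReal.ofReal (recenterR p β) * absMoment P p X ∧
    absMoment P p X = ENNReal.ofReal (|l| ^ p * ((1 - β) * |β - recenterT p β| ^ p +
      β * |-(1 - β) - recenterT p β| ^ p)) := by
  have h1 : 0 < 1 - β := by linarith [hβ.2]
  have hR := recenterR_pos hp hβ
  set τ := recenterT p β with hτ
  have e0 := absMoment_sub_of_map (p := p) hβ hXm h 0
  have e1 := absMoment_sub_of_map (p := p) hβ hXm h (∫ ω', X ω' ∂P)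
  rw [integral_of_map hβ hXm h] at e1 ⊢
  simp only [sub_zero, abs_mul, Real.mul_rpow (abs_nonneg l) (abs_nonneg _)] at e0
  rw [show l * (-(1 - β) - τ) - -l * τ = l * (-(1 - β)) by ring,
    show l * (β - τ) - -l * τ = l * β by ring] at e1
  simp only [abs_mul, Real.mul_rpow (abs_nonneg l) (abs_nonneg _)] at e1
  obtain ⟨-, -, h3⟩ := twoPoint_bound hp h1 hβ.1 τ
  simp only [sub_add_cancel, div_one, one_mul, ← hτ, iff_true] at h3
  constructor
  · rw [e0, e1, ← ENNReal.ofReal_mul hR.le]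
    congr 1
    linear_combination |l| ^ p * h3
  · rw [e0]
    congr 1
    ring

variable [IsProbabilityMeasure P]

lemma le_of_forall_centered_le (hp : 1 < p) {c : ℝ≥0∞}
    (h : ∀ (Ω : Type) [MeasurableSpace Ω] (P : Measure Ω) [IsProbabilityMeasure P] (X : Ω → ℝ),
      Integrable X P →
      absMoment P p (fun ω => X ω - ∫ ω', X ω' ∂P) ≤ c * absMoment P p X) :
    ENNReal.ofReal (recenterC p) ≤ c := by
  obtain ⟨β, hβ', hC⟩ := exists_recenterC_eq hp
  have hβ := mem_Ioo_one hβ'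
  have h1 : 0 < 1 - β := by linarith [hβ.2]
  have hP : IsProbabilityMeasure (twoPointLaw (1 - β) β) := by
    constructor
    simp only [twoPointLaw, sub_add_cancel, div_one, Measure.coe_add, Pi.add_apply,
      Measure.smul_apply, measure_univ, smul_eq_mul, mul_one]
    rw [← ENNReal.ofReal_add hβ.1.le h1.le]
    simp
  have hint : Integrable (fun x => (1 : ℝ) * (x - recenterT p β)) (twoPointLaw (1 - β) β) :=
    Integrable.add_measure ((integrable_dirac (by simp)).smul_measure ENNReal.ofReal_ne_top)
      ((integrable_dirac (by simp)).smul_measure ENNReal.ofReal_ne_top)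
  have h2 := h ℝ (twoPointLaw (1 - β) β) (fun x => (1 : ℝ) * (x - recenterT p β)) hint
  obtain ⟨e1, e2⟩ := centered_eq_of_map hp hβ hint.aemeasurable rfl
  rw [e1] at h2
  rw [hC]
  refine (ENNReal.mul_le_mul_iff_left ?_ ?_).1 h2
  · rw [e2]
    obtain ⟨h4, -, -⟩ := twoPoint_bound hp h1 hβ.1 (recenterT p β)
    simpa using h4
  · rw [e2]
    exact ENNReal.ofReal_ne_top

/-- Equality for `p ≠ 2` and `EX ≠ 0`: the contact set of the supporting line has one negative and
one positive point, since two contact points of opposite signs form an extremal two-point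
configuration, and there is only one of these with the given `EX`. -/
lemma exists_map_eq_of_centered_eq (hp : 1 < p) (hp2 : p ≠ 2) (hX : Integrable X P)
    (h : absMoment P p X < ∞)
    (heq : absMoment P p (fun ω => X ω - ∫ ω', X ω' ∂P) =
      ENNReal.ofReal (recenterC p) * absMoment P p X) (hm0 : ∫ ω, X ω ∂P ≠ 0) :
    ∃ l : ℝ, P.map X = (twoPointLaw (1 - recenterB p) (recenterB p)).map
      (fun x => l * (x - recenterT p (recenterB p))) := by
  have hpk := (isRecenterPeak_recenterB hp hp2).1
  have hpk1 := mem_Ioo_one hpk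
  have hT := recenterT_ne_zero hp hp2 hpk
  obtain ⟨l, hl, hae⟩ := (centered_le_of_lt_top hp hX h).2 heq
  set m := ∫ ω, X ω ∂P with hm
  set B := recenterB p with hB
  set T := recenterT p B with hTdef
  have hC := recenterC_eq hp hp2
  let Y : Ω → ℝ := fun ω => X ω - m
  have hY : Integrable Y P := hX.sub (integrable_const m)
  have hY0 : ∫ ω, Y ω ∂P = 0 := by
    simp only [Y]; rw [integral_sub hX (integrable_const m)]; simp [← hm]
  let E : Set ℝ := {y | |y| ^ p - recenterC p * |y + m| ^ p = l * y}
  have haeE : ∀ᵐ ω ∂P, Y ω ∈ E := by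
    filter_upwards [hae] with ω hω
    change |X ω - m| ^ p - recenterC p * |X ω - m + m| ^ p = l * (X ω - m)
    rwa [sub_add_cancel]
  have hE0 : (0 : ℝ) ∉ E := by
    intro h0
    have h0 : |(0 : ℝ)| ^ p - recenterC p * |0 + m| ^ p = l * 0 := h0
    rw [abs_zero, Real.zero_rpow (by linarith), zero_add, mul_zero] at h0
    have := mul_pos (recenterC_pos hp) (Real.rpow_pos_of_pos (abs_pos.2 hm0) p)
    linarith
  -- contact points of opposite signs are determined by `m`
  have hpair : ∀ a b : ℝ, 0 < a → 0 < b → -a ∈ E → b ∈ E →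
      (b = (a + b) * B ∧ -m = (a + b) * T) ∨
        (b = (a + b) * (1 - B) ∧ -m = (a + b) * (-T)) := by
    intro a b ha hb hEa hEb
    have hEa : |-a| ^ p - recenterC p * |-a + m| ^ p = l * -a := hEa
    have hEb : |b| ^ p - recenterC p * |b + m| ^ p = l * b := hEb
    obtain ⟨k1, k2, k3⟩ := twoPoint_bound hp ha hb (-m)
    rw [sub_neg_eq_add, sub_neg_eq_add] at k1 k2 k3
    have hmem := Ioo_subset_Icc_self (div_add_mem_Ioo ha hb)
    have k4 := recenterR_le_recenterC hp hmem
    have k5 : a * |b| ^ p + b * |-a| ^ p =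
        recenterC p * (a * |b + m| ^ p + b * |-a + m| ^ p) := by
      linear_combination b * hEa + a * hEb
    have k6 : recenterR p (b / (a + b)) = recenterC p := by
      apply le_antisymm k4
      rw [k5] at k2
      exact le_of_mul_le_mul_right k2 k1
    rw [k6] at k3
    have k7 := k3.1 k5
    have hab : b = (a + b) * (b / (a + b)) := by field_simp
    rcases eq_or_eq_of_recenterR_eq hp hp2 hmem (k6.trans hC) with h' | h'
    · rw [h'] at hab k7
      exact Or.inl ⟨hab, k7⟩
    · rw [h'] at hab k7
      rw [← hB, recenterT_one_sub hpk1] at k7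
      exact Or.inr ⟨hab, k7⟩
  have hpair_unique : ∀ a b a' b' : ℝ, 0 < a → 0 < b → 0 < a' → 0 < b' → -a ∈ E → b ∈ E →
      -a' ∈ E → b' ∈ E → a = a' ∧ b = b' := by
    intro a b a' b' ha hb ha' hb' h1 h2 h3 h4
    have hs : 0 < a + b := by positivity
    have hs' : 0 < a' + b' := by positivity
    rcases hpair a b ha hb h1 h2 with ⟨e1, e2⟩ | ⟨e1, e2⟩ <;>
    rcases hpair a' b' ha' hb' h3 h4 with ⟨e3, e4⟩ | ⟨e3, e4⟩
    · have e5 : a + b = a' + b' := mul_right_cancel₀ hT (e2.symm.trans e4)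
      have e6 : b = b' := by rw [e1, e3, e5]
      exact ⟨by linarith, e6⟩
    · exfalso
      have : (a + b + (a' + b')) * T = 0 := by linear_combination e4 - e2
      rcases mul_eq_zero.1 this with h | h
      · linarith
      · exact hT h
    · exfalso
      have : (a + b + (a' + b')) * T = 0 := by linear_combination e2 - e4
      rcases mul_eq_zero.1 this with h | h
      · linarith
      · exact hT h
    · have e5 : a + b = a' + b' := mul_right_cancel₀ (neg_ne_zero.2 hT) (e2.symm.trans e4)
      have e6 : b = b' := by rw [e1, e3, e5]
      exact ⟨by linarith, e6⟩
  -- a zero-mean variable that never vanishes takes values of both signs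
  have hpos : ∃ b, 0 < b ∧ b ∈ E := by
    by_contra! hno
    have hneg : ∀ᵐ ω ∂P, Y ω ≤ 0 := by
      filter_upwards [haeE] with ω hω
      by_contra! hlt
      exact hno _ hlt hω
    have h0 : ∀ᵐ ω ∂P, -Y ω = 0 := by
      have := (integral_eq_zero_iff_of_nonneg_ae (f := fun ω => -Y ω)
        (by filter_upwards [hneg] with ω hω; simpa using hω) hY.neg).1
        (by rw [integral_neg, hY0, neg_zero])
      filter_upwards [this] with ω hω using hω
    obtain ⟨ω, h5, h6⟩ := (h0.and haeE).exists
    rw [neg_eq_zero] at h5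
    exact hE0 (h5 ▸ h6)
  have hneg : ∃ a, 0 < a ∧ -a ∈ E := by
    by_contra! hno
    have hneg : ∀ᵐ ω ∂P, 0 ≤ Y ω := by
      filter_upwards [haeE] with ω hω
      by_contra! hlt
      exact hno (-Y ω) (by linarith) (by rwa [neg_neg])
    have h0 : ∀ᵐ ω ∂P, Y ω = 0 := by
      have := (integral_eq_zero_iff_of_nonneg_ae (f := Y) hneg hY).1 hY0
      filter_upwards [this] with ω hω using hω
    obtain ⟨ω, h5, h6⟩ := (h0.and haeE).exists
    exact hE0 (h5 ▸ h6)
  obtain ⟨b, hb, hbE⟩ := hpos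
  obtain ⟨a, ha, haE⟩ := hneg
  have hvals : ∀ᵐ ω ∂P, Y ω = -a ∨ Y ω = b := by
    filter_upwards [haeE] with ω hω
    rcases lt_trichotomy (Y ω) 0 with h5 | h5 | h5
    · left
      have := (hpair_unique a b (-Y ω) b ha hb (by linarith) hb haE hbE
        (by rwa [neg_neg]) hbE).1
      linarith
    · exact absurd (h5 ▸ hω) hE0
    · right
      exact (hpair_unique a b a (Y ω) ha hb ha h5 haE hbE haE hω).2.symm
  have hlaw := map_eq_twoPointLaw hY hY0 ha hb hvals
  have hXY : P.map X = (P.map Y).map (fun y => y + m) := by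
    rw [AEMeasurable.map_map_of_aemeasurable (by fun_prop) hY.aemeasurable]
    congr 1
    ext ω
    simp [Y]
  have hs : 0 < a + b := by positivity
  rw [hXY, hlaw, twoPointLaw_map (by fun_prop)]
  rcases hpair a b ha hb haE hbE with ⟨e1, e2⟩ | ⟨e1, e2⟩
  · refine ⟨a + b, ?_⟩
    rw [twoPointLaw_map_unit]
    have f1 : b / (a + b) = B := by rw [div_eq_iff hs.ne']; linarith
    have f2 : a / (a + b) = 1 - B := by rw [div_eq_iff hs.ne']; linarith
    rw [f1, f2, show -a + m = (a + b) * (-(1 - B) - T) by linarith,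
      show b + m = (a + b) * (B - T) by linarith]
  · refine ⟨-(a + b), ?_⟩
    rw [twoPointLaw_map_unit]
    have f1 : b / (a + b) = 1 - B := by rw [div_eq_iff hs.ne']; linarith
    have f2 : a / (a + b) = B := by rw [div_eq_iff hs.ne']; linarith
    rw [f1, f2, show -a + m = -(a + b) * (B - T) by linarith,
      show b + m = -(a + b) * (-(1 - B) - T) by linarith, add_comm]

/-- The cases of equality. For `p = 2` the difference of the two sides is `(EX)²`; for `p ≠ 2` and
`EX = 0`, `C_p > 1` forces `X = 0`, which is the scaling factor `l = 0`. -/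
lemma centered_eq_iff (hp : 1 < p) (hX : Integrable X P) :
    absMoment P p (fun ω => X ω - ∫ ω', X ω' ∂P) =
        ENNReal.ofReal (recenterC p) * absMoment P p X ↔
      absMoment P p X = ∞ ∨
      (p = 2 ∧ absMoment P 2 X < ∞ ∧ ∫ ω, X ω ∂P = 0) ∨
      (p ≠ 2 ∧ ∃ l : ℝ, P.map X =
        (twoPointLaw (1 - recenterB p) (recenterB p)).map
          (fun x => l * (x - recenterT p (recenterB p)))) := by
  by_cases htop : absMoment P p X = ∞
  · simp only [htop, true_or, iff_true]
    rw [← htop]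
    exact centered_eq_of_eq_top hp hX htop
  have hlt : absMoment P p X < ∞ := lt_top_iff_ne_top.2 htop
  simp only [htop, false_or]
  by_cases hp2 : p = 2
  · subst hp2
    simp only [ne_eq, not_true_eq_false, false_and, or_false, true_and, hlt, recenterC_two,
      ENNReal.ofReal_one, one_mul]
    set m := ∫ ω, X ω ∂P with hm
    constructor
    · intro heq
      have hXm := hX.aestronglyMeasurable
      have hYm : AEStronglyMeasurable (fun ω => X ω - m) P := hXm.sub aestronglyMeasurable_const
      have hY := (absMoment_sub_const_lt_top_iff hp hXm m).2 hlt
      have i1 := integrable_abs_rpow hp hXm hlt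
      rw [absMoment_eq_ofReal hp hXm hlt, absMoment_eq_ofReal hp hYm hY,
        ENNReal.ofReal_eq_ofReal_iff
          (integral_nonneg fun ω => Real.rpow_nonneg (abs_nonneg _) _)
          (integral_nonneg fun ω => Real.rpow_nonneg (abs_nonneg _) _)] at heq
      have e1 : (fun ω => |X ω - m| ^ (2 : ℝ)) =
          fun ω => |X ω| ^ (2 : ℝ) - (2 * m * X ω - m ^ 2) := by
        ext ω
        simp only [Real.rpow_two, sq_abs]
        ring
      have i2 : Integrable (fun ω => 2 * m * X ω - m ^ 2) P :=
        (hX.const_mul _).sub (integrable_const _)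
      rw [e1, integral_sub i1 i2, integral_sub (hX.const_mul _) (integrable_const _),
        integral_const_mul, ← hm] at heq
      simp only [integral_const, probReal_univ, one_smul] at heq
      nlinarith
    · intro h0
      simp [h0]
  · simp only [hp2, false_and, false_or, ne_eq, not_false_eq_true, true_and]
    have hpk := mem_Ioo_one (isRecenterPeak_recenterB hp hp2).1
    constructor
    · intro heq
      by_cases hm0 : ∫ ω, X ω ∂P = 0
      · -- `C_p > 1`, so `E|X|^p = 0`
        refine ⟨0, ?_⟩
        rw [hm0] at heq
        simp only [sub_zero] at heq
        have hz : absMoment P p X = 0 := by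
          by_contra hne
          have h1 : (1 : ℝ≥0∞) < ENNReal.ofReal (recenterC p) := by
            rw [ENNReal.one_lt_ofReal, recenterC_eq hp hp2]
            exact one_lt_recenterR_recenterB hp hp2
          have := ENNReal.mul_lt_mul_left hne htop h1
          rw [one_mul, ← heq] at this
          exact lt_irrefl _ this
        have hX0 : X =ᵐ[P] fun _ => 0 := by
          rw [absMoment, lintegral_eq_zero_iff' (by
            have := hX.aemeasurable
            fun_prop)] at hz
          filter_upwards [hz] with ω hω
          have hω : ENNReal.ofReal (|X ω| ^ p) = 0 := hω
          by_contra hne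
          have := Real.rpow_pos_of_pos (abs_pos.2 hne) p
          rw [ENNReal.ofReal_eq_zero] at hω
          linarith
        rw [Measure.map_congr hX0, twoPointLaw_map_unit, Measure.map_const]
        have h1 : 0 < 1 - recenterB p := by linarith [hpk.2]
        simp only [measure_univ, one_smul, zero_mul]
        rw [← add_smul, ← ENNReal.ofReal_add hpk.1.le h1.le]
        simp
      · exact exists_map_eq_of_centered_eq hp hp2 hX hlt heq hm0
    · rintro ⟨l, hl⟩
      rw [recenterC_eq hp hp2]
      exact (centered_eq_of_map hp hpk hX.aemeasurable hl).1

end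

/-! ### Asymptotics as `p → ∞` -/

/-- The arithmetic-geometric mean bound for the second factor of `R`. -/
lemma le_recenterR {s b : ℝ} (hs : 0 < s) (hb : b ∈ Ioo (0 : ℝ) 1) :
    (1 - b) ^ s * (2 ^ s * √(b * (1 - b))) ≤ recenterR (s + 1) b := by
  have h0 := hb.1
  have h1 : 0 < 1 - b := by linarith [hb.2]
  unfold recenterR
  rw [add_sub_cancel_right]
  have hbs : 0 < b ^ s := Real.rpow_pos_of_pos h0 s
  have hx : 0 < b ^ (1 / s) := Real.rpow_pos_of_pos h0 _
  have hy : 0 < (1 - b) ^ (1 / s) := Real.rpow_pos_of_pos h1 _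
  apply mul_le_mul (by linarith) _ (by positivity) (by positivity)
  have amgm : 2 * √(b ^ (1 / s) * (1 - b) ^ (1 / s)) ≤ b ^ (1 / s) + (1 - b) ^ (1 / s) := by
    rw [Real.sqrt_mul' _ hy.le]
    nlinarith [sq_nonneg (√(b ^ (1 / s)) - √((1 - b) ^ (1 / s))), Real.sq_sqrt hx.le,
      Real.sq_sqrt hy.le]
  have := Real.rpow_le_rpow (by positivity) amgm hs.le
  refine le_of_eq_of_le ?_ this
  rw [Real.mul_rpow (by norm_num) (by positivity), ← Real.mul_rpow h0.le h1.le,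
    Real.sqrt_eq_rpow, Real.sqrt_eq_rpow, ← Real.rpow_mul (by positivity),
    ← Real.rpow_mul (by positivity)]
  congr 2
  field_simp

lemma exp_neg_mul_sqrt_le (y : ℝ) :
    Real.exp (-y) * √y ≤ 1 / √(2 * Real.exp 1) := by
  have h : Real.exp (-y) ^ 2 * y ≤ 1 / (2 * Real.exp 1) := by
    have h1 := Real.add_one_le_exp (2 * y - 1)
    have h2 : Real.exp (-y) ^ 2 * Real.exp (2 * y - 1) = 1 / Real.exp 1 := by
      rw [← Real.exp_nat_mul, ← Real.exp_add, one_div, ← Real.exp_neg]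
      congr 1
      push_cast
      ring
    have h3 : 0 < Real.exp (-y) ^ 2 := by positivity
    calc Real.exp (-y) ^ 2 * y = Real.exp (-y) ^ 2 * (2 * y - 1 + 1) / 2 := by ring
      _ ≤ Real.exp (-y) ^ 2 * Real.exp (2 * y - 1) / 2 := by gcongr
      _ = _ := by rw [h2]; field_simp
  calc Real.exp (-y) * √y = √(Real.exp (-y) ^ 2 * y) := by
        rw [Real.sqrt_mul (by positivity), Real.sqrt_sq (Real.exp_pos _).le]
    _ ≤ √(1 / (2 * Real.exp 1)) := Real.sqrt_le_sqrt h
    _ = _ := by rw [Real.sqrt_div zero_le_one, Real.sqrt_one]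

/-- With `z = log c`, the left side is `2^s √c cosh (z / (2 s)) ^ s`. -/
lemma rpow_add_one_rpow_le {s c : ℝ} (hs : 0 < s) (hc : 0 < c) :
    (c ^ (1 / s) + 1) ^ s ≤ 2 ^ s * √c * Real.exp (Real.log c ^ 2 / (8 * s)) := by
  set z := Real.log c with hz
  have e1 : c ^ (1 / s) + 1 = 2 * Real.exp (z / (2 * s)) * Real.cosh (z / (2 * s)) := by
    rw [Real.rpow_def_of_pos hc, ← hz, Real.cosh_eq]
    have : Real.exp (z * (1 / s)) = Real.exp (z / (2 * s)) * Real.exp (z / (2 * s)) := by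
      rw [← Real.exp_add]; congr 1; field_simp; ring
    have h2 : Real.exp (z / (2 * s)) * Real.exp (-(z / (2 * s))) = 1 := by
      rw [← Real.exp_add]; simp
    rw [this]
    linear_combination -h2
  have e2 : √c = Real.exp (z / 2) := by
    rw [Real.sqrt_eq_rpow, Real.rpow_def_of_pos hc, ← hz]; congr 1; ring
  rw [e1, e2]
  calc (2 * Real.exp (z / (2 * s)) * Real.cosh (z / (2 * s))) ^ s
      ≤ (2 * Real.exp (z / (2 * s)) * Real.exp ((z / (2 * s)) ^ 2 / 2)) ^ s := by
        have := Real.cosh_pos (z / (2 * s))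
        apply Real.rpow_le_rpow (by positivity) _ hs.le
        gcongr
        exact Real.cosh_le_exp_half_sq _
    _ = _ := by
        rw [Real.mul_rpow (by positivity) (by positivity),
          Real.mul_rpow (by positivity) (by positivity), ← Real.exp_mul, ← Real.exp_mul,
          show z / (2 * s) * s = z / 2 by field_simp,
          show (z / (2 * s)) ^ 2 / 2 * s = z ^ 2 / (8 * s) by field_simp; norm_num]

/-- The leading part of the bound is the maximum over `b` of the main term `2^s √b exp (-s b)`.
For `b < 1 / s²` the second factor of `R` is estimated by its value at `1 / s²`. -/
lemma sqrt_mul_recenterR_le {s b : ℝ} (hs : 6 ≤ s) (hb : b ∈ Ioo (0 : ℝ) (1 / 2)) :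
    √s * recenterR (s + 1) b / 2 ^ s ≤
      (1 / √(2 * Real.exp 1) + √s * Real.exp (-Real.log 2 * s)) *
        Real.exp (Real.log s ^ 2 / s / 2) := by
  have hs0 : 0 < s := by linarith
  have h0 := hb.1
  have h1 : 0 < 1 - b := by linarith [hb.2]
  have h2s : (0 : ℝ) < 2 ^ s := by positivity
  set ρ := Real.exp (-Real.log 2 * s) with hρ
  have hρ0 : 0 < ρ := Real.exp_pos _
  set c := max b (1 / s ^ 2) with hc
  have hs2 : 1 / s ^ 2 ≤ 1 := by rw [div_le_one (by positivity)]; nlinarith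
  have hc0 : 0 < c := lt_of_lt_of_le h0 (le_max_left _ _)
  have hc1 : c ≤ 1 := max_le (by linarith [hb.2]) hs2
  have f1 : b ^ s + (1 - b) ^ s ≤ ρ + Real.exp (-(s * b)) := by
    apply add_le_add
    · calc b ^ s ≤ (1 / 2) ^ s := Real.rpow_le_rpow h0.le hb.2.le hs0.le
        _ = ρ := by rw [Real.rpow_def_of_pos (by norm_num), hρ, one_div, Real.log_inv]
    · calc (1 - b) ^ s ≤ Real.exp (-b) ^ s :=
            Real.rpow_le_rpow h1.le (by linarith [Real.add_one_le_exp (-b)]) hs0.le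
        _ = _ := by rw [← Real.exp_mul]; congr 1; ring
  have hlog : Real.log c ^ 2 ≤ (2 * Real.log s) ^ 2 := by
    have l1 : Real.log c ≤ 0 := Real.log_nonpos hc0.le hc1
    have l2 : -(2 * Real.log s) ≤ Real.log c := by
      have e : Real.log (1 / s ^ 2) = -(2 * Real.log s) := by
        rw [one_div, Real.log_inv, Real.log_pow]; norm_num
      rw [← e]
      exact Real.log_le_log (by positivity) (le_max_right b (1 / s ^ 2))
    exact sq_le_sq' l2 (by linarith)
  have f2 : (b ^ (1 / s) + (1 - b) ^ (1 / s)) ^ s ≤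
      2 ^ s * √c * Real.exp (Real.log s ^ 2 / s / 2) := by
    have hx : 0 < b ^ (1 / s) := Real.rpow_pos_of_pos h0 _
    have hy : 0 < (1 - b) ^ (1 / s) := Real.rpow_pos_of_pos h1 _
    have hi : 0 ≤ 1 / s := by positivity
    calc (b ^ (1 / s) + (1 - b) ^ (1 / s)) ^ s ≤ (c ^ (1 / s) + 1) ^ s := by
          apply Real.rpow_le_rpow (by positivity) _ hs0.le
          exact add_le_add (Real.rpow_le_rpow h0.le (le_max_left _ _) hi)
            (Real.rpow_le_one h1.le (by linarith) hi)
      _ ≤ 2 ^ s * √c * Real.exp (Real.log c ^ 2 / (8 * s)) := rpow_add_one_rpow_le hs0 hc0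
      _ ≤ _ := by
          gcongr 2 ^ s * √c * Real.exp ?_
          rw [div_div, div_le_div_iff₀ (by positivity) (by positivity)]
          nlinarith
  have f3 : √s * √c * (ρ + Real.exp (-(s * b))) ≤ 1 / √(2 * Real.exp 1) + √s * ρ := by
    have hc' : √c ≤ 1 := Real.sqrt_le_one.2 hc1
    have g1 : √s * √c * ρ ≤ √s * ρ := by
      have : √s * √c ≤ √s := mul_le_of_le_one_right (Real.sqrt_nonneg s) hc'
      exact mul_le_mul_of_nonneg_right this hρ0.le
    have g2 : √s * √c * Real.exp (-(s * b)) ≤ 1 / √(2 * Real.exp 1) := by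
      rcases le_total (1 / s ^ 2) b with h | h
      · rw [hc, max_eq_left h, ← Real.sqrt_mul hs0.le, mul_comm]
        exact exp_neg_mul_sqrt_le _
      · rw [hc, max_eq_right h, ← Real.sqrt_mul hs0.le]
        have : Real.exp (-(s * b)) ≤ 1 := Real.exp_le_one_iff.2 (by nlinarith)
        have e : √(s * (1 / s ^ 2)) = 1 / √s := by
          rw [show s * (1 / s ^ 2) = 1 / s by field_simp, Real.sqrt_div zero_le_one, Real.sqrt_one]
        have he := Real.exp_one_lt_d9
        calc √(s * (1 / s ^ 2)) * Real.exp (-(s * b)) ≤ √(s * (1 / s ^ 2)) * 1 := by gcongr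
          _ = 1 / √s := by rw [e, mul_one]
          _ ≤ 1 / √(2 * Real.exp 1) := by
            apply one_div_le_one_div_of_le (by positivity)
            apply Real.sqrt_le_sqrt
            linarith
    linarith
  have hR : recenterR (s + 1) b ≤
      (ρ + Real.exp (-(s * b))) * (2 ^ s * √c * Real.exp (Real.log s ^ 2 / s / 2)) := by
    unfold recenterR
    rw [add_sub_cancel_right]
    exact mul_le_mul f1 f2 (by positivity) (by positivity)
  rw [div_le_iff₀ h2s]
  calc √s * recenterR (s + 1) b
      ≤ √s * ((ρ + Real.exp (-(s * b))) * (2 ^ s * √c * Real.exp (Real.log s ^ 2 / s / 2))) := by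
        gcongr
    _ = (√s * √c * (ρ + Real.exp (-(s * b)))) * Real.exp (Real.log s ^ 2 / s / 2) * 2 ^ s := by
        ring
    _ ≤ _ := by gcongr

/-- The lower bound comes from `b = 1 / (2 s)`, the maximizer of the main term. -/
lemma tendsto_sqrt_mul_recenterC :
    Tendsto (fun s : ℝ => √s * recenterC (s + 1) / 2 ^ s) atTop
      (𝓝 (1 / √(2 * Real.exp 1))) := by
  have hlow : Tendsto (fun s : ℝ => (1 + (-1 / 2) / s) ^ s * √((1 + (-1 / 2) / s) / 2)) atTop
      (𝓝 (1 / √(2 * Real.exp 1))) := by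
    have h1 := Real.tendsto_one_add_div_rpow_exp (-1 / 2)
    have h2 : Tendsto (fun s : ℝ => √((1 + (-1 / 2) / s) / 2)) atTop (𝓝 √((1 + 0) / 2)) :=
      (((tendsto_const_nhds.div_atTop tendsto_id).const_add 1).div_const 2).sqrt
    have := h1.mul h2
    convert this using 2
    rw [Real.sqrt_mul (by norm_num), add_zero, Real.sqrt_div zero_le_one, Real.sqrt_one,
      ← Real.exp_half, neg_div, Real.exp_neg]
    field_simp
  have hup : Tendsto (fun s : ℝ => (1 / √(2 * Real.exp 1) + √s * Real.exp (-Real.log 2 * s)) *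
        Real.exp (Real.log s ^ 2 / s / 2)) atTop (𝓝 (1 / √(2 * Real.exp 1))) := by
    have h1 : Tendsto (fun s : ℝ => √s * Real.exp (-Real.log 2 * s)) atTop (𝓝 0) := by
      have := tendsto_rpow_mul_exp_neg_mul_atTop_nhds_zero (1 / 2) (Real.log 2)
        (Real.log_pos one_lt_two)
      simpa only [← Real.sqrt_eq_rpow] using this
    have h2 : Tendsto (fun s : ℝ => Real.log s ^ 2 / s / 2) atTop (𝓝 (0 / 2)) :=
      ((Real.isLittleO_pow_log_id_atTop (n := 2)).tendsto_div_nhds_zero).div_const 2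
    have h3 := (h1.const_add (1 / √(2 * Real.exp 1))).mul
      ((Real.continuous_exp.tendsto _).comp h2)
    simpa using h3
  refine tendsto_of_tendsto_of_tendsto_of_le_of_le' hlow hup ?_ ?_
  · filter_upwards [eventually_ge_atTop 6] with s hs
    have hs0 : 0 < s := by linarith
    have hb : 1 / (2 * s) ∈ Ioo (0 : ℝ) 1 :=
      ⟨by positivity, by rw [div_lt_one (by positivity)]; linarith⟩
    have h1 := (le_recenterR hs0 hb).trans
      (recenterR_le_recenterC (by linarith) (Ioo_subset_Icc_self hb))
    rw [le_div_iff₀ (by positivity)]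
    have e : 1 + -1 / 2 / s = 1 - 1 / (2 * s) := by field_simp; ring
    rw [e]
    have e2 : √((1 - 1 / (2 * s)) / 2) = √s * √(1 / (2 * s) * (1 - 1 / (2 * s))) := by
      rw [← Real.sqrt_mul hs0.le]
      congr 1
      field_simp
    rw [e2]
    calc _ = √s * ((1 - 1 / (2 * s)) ^ s * (2 ^ s * √(1 / (2 * s) * (1 - 1 / (2 * s))))) := by
          ring
      _ ≤ _ := by gcongr
  · filter_upwards [eventually_ge_atTop 6] with s hs
    obtain ⟨β, hβ, h⟩ := exists_recenterC_eq (p := s + 1) (by linarith)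
    rw [h]
    exact sqrt_mul_recenterR_le hs hβ

lemma tendsto_recenterC_div :
    Tendsto (fun p : ℝ => recenterC p / (2 ^ p / √(8 * Real.exp 1 * p))) atTop (𝓝 1) := by
  have h1 : Tendsto (fun p : ℝ => p - 1) atTop atTop :=
    tendsto_atTop_add_const_right _ (-1) tendsto_id
  have h2 := tendsto_sqrt_mul_recenterC.comp h1
  have h3 : Tendsto (fun p : ℝ => √(1 + 1 / (p - 1))) atTop (𝓝 √(1 + 0)) :=
    ((tendsto_const_nhds.div_atTop h1).const_add 1).sqrt
  have h4 := (h2.mul h3).const_mul √(2 * Real.exp 1)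
  have h0 : √(2 * Real.exp 1) ≠ 0 := by positivity
  rw [add_zero, Real.sqrt_one, mul_one, mul_one_div_cancel h0] at h4
  refine h4.congr' ?_
  filter_upwards [eventually_gt_atTop 1] with p hp
  have hs : 0 < p - 1 := by linarith
  simp only [Function.comp, sub_add_cancel]
  have e1 : √(1 + 1 / (p - 1)) = √p / √(p - 1) := by
    rw [← Real.sqrt_div (by linarith)]
    congr 1
    field_simp
    ring
  have e2 : √(8 * Real.exp 1 * p) = 2 * √(2 * Real.exp 1) * √p := by
    rw [show 8 * Real.exp 1 * p = 2 ^ 2 * (2 * Real.exp 1) * p by ring,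
      Real.sqrt_mul (by positivity), Real.sqrt_mul (by positivity), Real.sqrt_sq (by norm_num)]
  have e3 : (2 : ℝ) ^ p = 2 ^ (p - 1) * 2 := by
    rw [Real.rpow_sub_one (by norm_num)]; field_simp
  have : √(p - 1) ≠ 0 := by positivity
  have : (2 : ℝ) ^ (p - 1) ≠ 0 := by positivity
  rw [e1, e2, e3]
  field_simp

/-! ### Duality, convexity and monotonicity in `p` -/

lemma recenterR_dual {s b : ℝ} (hs : 0 < s) (hb : b ∈ Icc (0 : ℝ) 1) :
    recenterR (s⁻¹ + 1) b = recenterR (s + 1) b ^ s⁻¹ := by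
  have h1 : 0 ≤ 1 - b := by linarith [hb.2]
  have h2 : ∀ r : ℝ, 0 ≤ b ^ r + (1 - b) ^ r := fun r =>
    add_nonneg (Real.rpow_nonneg hb.1 r) (Real.rpow_nonneg h1 r)
  unfold recenterR
  simp only [add_sub_cancel_right, one_div, inv_inv]
  rw [Real.mul_rpow (h2 _) (Real.rpow_nonneg (h2 _) _), ← Real.rpow_mul (h2 _),
    mul_inv_cancel₀ hs.ne', Real.rpow_one, mul_comm]

lemma recenterC_dual {s : ℝ} (hs : 0 < s) :
    recenterC (s⁻¹ + 1) = recenterC (s + 1) ^ s⁻¹ := by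
  have hi : 0 < s⁻¹ := inv_pos.2 hs
  obtain ⟨β, hβ', hmax, -⟩ := exists_isMax (p := s + 1) (by linarith)
  have hβ := mem_Ioo_one hβ'
  rw [recenterC_eq_of_isMax (by linarith) hβ hmax, ← recenterR_dual hs (Ioo_subset_Icc_self hβ)]
  refine recenterC_eq_of_isMax (by linarith) hβ fun b hb => ?_
  rw [recenterR_dual hs hb, recenterR_dual hs (Ioo_subset_Icc_self hβ)]
  refine Real.rpow_le_rpow ?_ (hmax b hb) hi.le
  have h1 : 0 ≤ 1 - b := by linarith [hb.2]
  have h0 := hb.1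
  unfold recenterR
  positivity

lemma recenterB_dual {s : ℝ} (hs : 0 < s) (hs1 : s ≠ 1) :
    recenterB (s⁻¹ + 1) = recenterB (s + 1) := by
  have hi : 0 < s⁻¹ := inv_pos.2 hs
  have hpk := isRecenterPeak_recenterB (p := s + 1) (by linarith) (fun h => hs1 (by linarith))
  apply recenterB_eq_of_isRecenterPeak
  refine ⟨hpk.1, fun x hx => ?_, fun x hx => ?_⟩
  · have hx1 : x ∈ Ioo (0 : ℝ) 1 := mem_Ioo_one ⟨hx.1, hx.2.trans hpk.1.2⟩
    have := hpk.2.1 x hx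
    rw [deriv_recenterR_pos_iff (by linarith) hx1, add_sub_cancel_right] at this ⊢
    rw [logRSlope_inv hs]
    exact div_neg_of_neg_of_pos this hs
  · have hx1 : x ∈ Ioo (0 : ℝ) 1 := mem_Ioo_one ⟨hpk.1.1.trans hx.1, hx.2⟩
    have := hpk.2.2 x hx
    rw [deriv_recenterR_neg_iff (by linarith) hx1, add_sub_cancel_right] at this ⊢
    rw [logRSlope_inv hs]
    exact div_pos this hs

lemma conj_exponent {p q : ℝ} (hp : 1 < p) (hpq : 1 / p + 1 / q = 1) :
    q = (p - 1)⁻¹ + 1 := by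
  have hs : p - 1 ≠ 0 := by linarith
  have hp0 : p ≠ 0 := by linarith
  have h1 : 1 / q = (p - 1) / p := by
    have : 1 / q = 1 - 1 / p := by linarith
    rw [this]; field_simp
  have h2 : q = p / (p - 1) := by rw [← one_div_one_div q, h1, one_div_div]
  rw [h2]
  field_simp
  ring

lemma duality {p q : ℝ} (hp : 1 < p) (hpq : 1 / p + 1 / q = 1) :
    recenterC p ^ (1 / √(p - 1)) = recenterC q ^ (1 / √(q - 1)) ∧
      (p ≠ 2 → recenterB p = recenterB q) := by
  have hs : 0 < p - 1 := by linarith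
  obtain rfl := conj_exponent hp hpq
  have hC := recenterC_dual hs
  rw [sub_add_cancel] at hC
  constructor
  · rw [hC, add_sub_cancel_right, ← Real.rpow_mul (recenterC_pos hp).le, Real.sqrt_inv]
    congr 1
    have h1 : √(p - 1) * √(p - 1) = p - 1 := Real.mul_self_sqrt hs.le
    have h2 : 0 < √(p - 1) := Real.sqrt_pos.2 hs
    field_simp
    nlinarith
  · intro hp2
    have := recenterB_dual hs (fun h => hp2 (by linarith))
    rw [sub_add_cancel] at this
    exact this.symm

lemma strictConvexOn_log_cosh :
    StrictConvexOn ℝ univ fun u => Real.log (Real.cosh u) := by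
  apply StrictMono.strictConvexOn_univ_of_deriv
  · exact continuous_iff_continuousAt.2 fun u => (hasDerivAt_log_cosh u).continuousAt
  · rw [show deriv (fun u => Real.log (Real.cosh u)) = Real.tanh from
      funext fun u => (hasDerivAt_log_cosh u).deriv]
    exact tanh_strictMono

/-- For a fixed `u ≠ 0`, `log R` is strictly convex in the exponent: `s log (cosh (u / s))` is the
perspective of the convex function `log cosh`. -/
lemma strictConvexOn_logR {u : ℝ} (hu : u ≠ 0) :
    StrictConvexOn ℝ (Ioi 0) fun s => logR s u := by
  refine ⟨convex_Ioi 0, ?_⟩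
  intro x hx y hy hxy a b ha hb hab
  have hx : 0 < x := hx
  have hy : 0 < y := hy
  simp only [smul_eq_mul]
  have hz : 0 < a * x + b * y := by positivity
  set z := a * x + b * y with hzdef
  set L : ℝ → ℝ := fun u => Real.log (Real.cosh u) with hL
  have h1 : L (z * u) < a * L (x * u) + b * L (y * u) := by
    have := strictConvexOn_log_cosh.2 (mem_univ (x * u)) (mem_univ (y * u))
      (fun h => hxy (mul_right_cancel₀ hu h)) ha hb hab
    simp only [smul_eq_mul] at this
    rwa [show a * (x * u) + b * (y * u) = z * u by rw [hzdef]; ring] at this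
  have h2 : z * L (u / z) ≤ a * (x * L (u / x)) + b * (y * L (u / y)) := by
    have := strictConvexOn_log_cosh.convexOn.2 (mem_univ (u / x)) (mem_univ (u / y))
      (show 0 ≤ a * x / z by positivity) (show 0 ≤ b * y / z by positivity)
      (by rw [← add_div, ← hzdef, div_self hz.ne'])
    simp only [smul_eq_mul] at this
    rw [show a * x / z * (u / x) + b * y / z * (u / y) = u / z by
      field_simp
      exact hab] at this
    have := mul_le_mul_of_nonneg_left this hz.le
    refine this.trans (le_of_eq ?_)
    simp only [hL]
    field_simp
  change L (z * u) + z * L (u / z) - (z + 1) * L u <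
    a * (L (x * u) + x * L (u / x) - (x + 1) * L u) +
      b * (L (y * u) + y * L (u / y) - (y + 1) * L u)
  have h3 : (z + 1) * L u = a * ((x + 1) * L u) + b * ((y + 1) * L u) := by
    rw [hzdef]; linear_combination (-L u) * hab
  linarith

lemma logR_le_log_recenterC {p u : ℝ} (hp : 1 < p) :
    logR (p - 1) u ≤ Real.log (recenterC p) := by
  have := recenterR_le_recenterC hp (Ioo_subset_Icc_self (halfLogistic_mem u))
  rw [recenterR_halfLogistic hp] at this
  rwa [Real.le_log_iff_exp_le (recenterC_pos hp)]

lemma strictConvexOn_log_recenterC :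
    StrictConvexOn ℝ (Ioi 1) fun p => Real.log (recenterC p) := by
  refine ⟨convex_Ioi 1, ?_⟩
  intro x hx y hy hxy a b ha hb hab
  have hx : 1 < x := hx
  have hy : 1 < y := hy
  simp only [smul_eq_mul]
  have hz : 1 < a * x + b * y := by nlinarith
  obtain ⟨β, hβ, h⟩ := exists_recenterC_eq hz
  have hu := halfLogit_pos hβ
  set u := halfLogit β
  rw [h, recenterR_eq_exp hz (mem_Ioo_one hβ), Real.log_exp]
  have hconv := (strictConvexOn_logR hu.ne').2 (show x - 1 ∈ Ioi 0 by simpa using hx)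
    (show y - 1 ∈ Ioi 0 by simpa using hy) (fun h => hxy (by linarith)) ha hb hab
  simp only [smul_eq_mul] at hconv
  rw [show a * (x - 1) + b * (y - 1) = a * x + b * y - 1 by linear_combination -hab] at hconv
  have h1 := mul_le_mul_of_nonneg_left (logR_le_log_recenterC (u := u) hx) ha.le
  have h2 := mul_le_mul_of_nonneg_left (logR_le_log_recenterC (u := u) hy) hb.le
  linarith

lemma continuousOn_recenterC : ContinuousOn recenterC (Ioi 1) := by
  have h := strictConvexOn_log_recenterC.convexOn.continuousOn isOpen_Ioi
  refine (Real.continuous_exp.comp_continuousOn h).congr fun p hp => ?_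
  exact (Real.exp_log (recenterC_pos hp)).symm

/-- `log C_p` has its minimum, `0`, at `p = 2`; with convexity this makes `C_p` monotone on either
side. -/
lemma log_recenterC_pos {p : ℝ} (hp : 1 < p) (hp2 : p ≠ 2) : 0 < Real.log (recenterC p) := by
  rw [recenterC_eq hp hp2]
  exact Real.log_pos (one_lt_recenterR_recenterB hp hp2)

lemma log_recenterC_two : Real.log (recenterC 2) = 0 := by
  rw [recenterC_two, Real.log_one]

lemma strictAntiOn_recenterC : StrictAntiOn recenterC (Ioc 1 2) := by
  intro x hx y hy hxy
  rw [← Real.log_lt_log_iff (recenterC_pos hy.1) (recenterC_pos hx.1)]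
  rcases hy.2.eq_or_lt with rfl | h
  · rw [log_recenterC_two]
    exact log_recenterC_pos hx.1 hxy.ne
  · refine strictConvexOn_log_recenterC.convexOn.lt_left_of_right_lt (y := 2) hx.1
      (show (2 : ℝ) ∈ Ioi 1 by norm_num) ?_ ?_
    · rw [openSegment_eq_Ioo (hxy.trans h)]
      exact ⟨hxy, h⟩
    · rw [log_recenterC_two]
      exact log_recenterC_pos hy.1 h.ne

lemma strictMonoOn_recenterC : StrictMonoOn recenterC (Ici 2) := by
  intro x hx y hy hxy
  have hx : 2 ≤ x := hx
  rw [← Real.log_lt_log_iff (recenterC_pos (by linarith)) (recenterC_pos (by linarith))]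
  rcases hx.eq_or_lt with rfl | h
  · rw [log_recenterC_two]
    exact log_recenterC_pos (by linarith) hxy.ne'
  · refine strictConvexOn_log_recenterC.convexOn.lt_right_of_left_lt (x := 2)
      (show (2 : ℝ) ∈ Ioi 1 by norm_num) (show y ∈ Ioi 1 from (by linarith : (1 : ℝ) < y)) ?_ ?_
    · rw [openSegment_eq_Ioo (h.trans hxy)]
      exact ⟨h, hxy⟩
    · rw [log_recenterC_two]
      exact log_recenterC_pos (by linarith) h.ne'

lemma tendsto_recenterC_atTop : Tendsto recenterC atTop atTop := by
  have h1 : Tendsto (fun p : ℝ => p - 1) atTop atTop :=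
    tendsto_atTop_add_const_right _ (-1) tendsto_id
  have h2 := ((tendsto_rpow_atTop_of_base_gt_one (3 / 2) (by norm_num)).comp h1).atTop_mul_const
    (show 0 < √(1 / 4 * (1 - 1 / 4) : ℝ) by norm_num)
  refine tendsto_atTop_mono' _ ?_ h2
  filter_upwards [eventually_gt_atTop 1] with p hp
  have hs : 0 < p - 1 := by linarith
  have h3 := le_recenterR hs (show (1 / 4 : ℝ) ∈ Ioo 0 1 by norm_num)
  rw [sub_add_cancel] at h3
  refine le_trans (le_of_eq ?_) (h3.trans (recenterR_le_recenterC hp (by norm_num)))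
  simp only [Function.comp]
  rw [← mul_assoc, ← Real.mul_rpow (by norm_num) (by norm_num)]
  norm_num

lemma tendsto_recenterC_rpow_inv :
    Tendsto (fun s : ℝ => recenterC (s + 1) ^ s⁻¹) atTop (𝓝 2) := by
  have h0 : Tendsto (fun s : ℝ => s⁻¹) atTop (𝓝 0) := tendsto_inv_atTop_zero
  have h1 := tendsto_sqrt_mul_recenterC.rpow h0
    (Or.inl (by positivity : 1 / √(2 * Real.exp 1) ≠ 0))
  rw [Real.rpow_zero] at h1
  have h2 : Tendsto (fun s : ℝ => √(s ^ ((1 : ℝ) / s))) atTop (𝓝 √1) := tendsto_rpow_div.sqrt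
  have h3 := (h1.div h2 (by simp)).const_mul 2
  simp only [Real.sqrt_one, div_one, mul_one] at h3
  refine h3.congr' ?_
  filter_upwards [eventually_gt_atTop 0] with s hs
  have hC := recenterC_pos (p := s + 1) (by linarith)
  have e : √(s ^ ((1 : ℝ) / s)) = √s ^ s⁻¹ := by
    rw [Real.sqrt_eq_rpow, Real.sqrt_eq_rpow, ← Real.rpow_mul hs.le, ← Real.rpow_mul hs.le]
    congr 1
    field_simp
  have h4 : 0 < √s ^ s⁻¹ := Real.rpow_pos_of_pos (Real.sqrt_pos.2 hs) _
  rw [Pi.div_apply, e, Real.div_rpow (by positivity) (by positivity),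
    Real.mul_rpow (by positivity) hC.le, ← Real.rpow_mul (by norm_num) s,
    mul_inv_cancel₀ hs.ne', Real.rpow_one]
  field_simp

/-- With `s = 1 / (p - 1)` the conjugate exponent of `p` is `s + 1`, so `C_p = C_{s+1} ^ (1/s)`. -/
lemma tendsto_recenterC_one : Tendsto recenterC (𝓝[>] 1) (𝓝 2) := by
  have h1 : Tendsto (fun p : ℝ => (p - 1)⁻¹) (𝓝[>] 1) atTop := by
    apply tendsto_inv_nhdsGT_zero.comp
    apply tendsto_nhdsWithin_of_tendsto_nhds_of_eventually_within
    · have : Tendsto (fun p : ℝ => p - 1) (𝓝 1) (𝓝 (1 - 1)) := tendsto_id.sub_const 1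
      rw [sub_self] at this
      exact this.mono_left nhdsWithin_le_nhds
    · filter_upwards [self_mem_nhdsWithin] with p hp
      have hp : 1 < p := hp
      exact sub_pos.2 hp
  refine (tendsto_recenterC_rpow_inv.comp h1).congr' ?_
  filter_upwards [self_mem_nhdsWithin] with p hp
  have hp : 1 < p := hp
  have hs : 0 < (p - 1)⁻¹ := inv_pos.2 (by linarith)
  have := recenterC_dual hs
  rw [inv_inv, sub_add_cancel] at this
  simp only [Function.comp, inv_inv]
  exact this.symm

/-! ### Algebraicity and the case `p = 3` -/

lemma logRSlope_recenterB {p : ℝ} (hp : 1 < p) (hp2 : p ≠ 2) :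
    logRSlope (p - 1) (halfLogit (recenterB p)) = 0 := by
  have hB := (isRecenterPeak_recenterB hp hp2).1
  have hB1 := mem_Ioo_one hB
  have hmax : IsLocalMax (recenterR p) (recenterB p) := by
    filter_upwards [isOpen_Ioo.mem_nhds hB1] with b hb
    exact recenterR_le_recenterB hp hp2 (Ioo_subset_Icc_self hb)
  have h := hmax.hasDerivAt_eq_zero (hasDerivAt_recenterR hp hB1)
  exact (mul_eq_zero.1 h).resolve_left (neg_ne_zero.2 (deriv_recenterR_factor_pos hp hB1).ne')

lemma recenterB_eq_of_logRSlope_eq_zero {p u : ℝ} (hp : 1 < p) (hp2 : p ≠ 2) (hu : 0 < u)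
    (h : logRSlope (p - 1) u = 0) : recenterB p = halfLogistic u := by
  obtain ⟨hB, h1, h2⟩ := isRecenterPeak_recenterB hp hp2
  have hmem := halfLogistic_pos_lt_half hu
  have hmem1 := mem_Ioo_one hmem
  rcases lt_trichotomy (recenterB p) (halfLogistic u) with h3 | h3 | h3
  · have := h2 _ ⟨h3, hmem.2⟩
    rw [deriv_recenterR_neg_iff hp hmem1, halfLogit_halfLogistic, h] at this
    exact absurd this (lt_irrefl _)
  · exact h3
  · have := h1 _ ⟨hmem.1, h3⟩
    rw [deriv_recenterR_pos_iff hp hmem1, halfLogit_halfLogistic, h] at this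
    exact absurd this (lt_irrefl _)

lemma tanh_eq_exp (x : ℝ) :
    Real.tanh x = (1 - Real.exp (-(2 * x))) / (1 + Real.exp (-(2 * x))) := by
  have h : Real.exp (-(2 * x)) = Real.exp (-x) / Real.exp x := by
    rw [← Real.exp_sub]; congr 1; ring
  have h1 := Real.exp_pos x
  have h2 := Real.exp_pos (-x)
  rw [Real.tanh_eq, h]
  field_simp

/-- The polynomial form, for `s = m / n`, of the equation `logRSlope s u = 0` in the variable
`y = exp (-2 u / (m n))`. -/
noncomputable def critPoly (m n : ℕ) : Polynomial ℚ :=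
  (m : Polynomial ℚ) * (1 - .X ^ (m * m)) * (1 + .X ^ (n * n)) * (1 + .X ^ (m * n)) +
    (n : Polynomial ℚ) * (1 - .X ^ (n * n)) * (1 + .X ^ (m * m)) * (1 + .X ^ (m * n)) -
    ((m : Polynomial ℚ) + (n : Polynomial ℚ)) * (1 - .X ^ (m * n)) * (1 + .X ^ (m * m)) *
      (1 + .X ^ (n * n))

lemma aeval_critPoly_eq_zero_iff {m n : ℕ} (hm : 0 < m) (hn : 0 < n) (u : ℝ) :
    Polynomial.aeval (Real.exp (-(2 * u / (m * n)))) (critPoly m n) = 0 ↔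
      logRSlope ((m : ℝ) / n) u = 0 := by
  have hm' : (0 : ℝ) < m := by exact_mod_cast hm
  have hn' : (0 : ℝ) < n := by exact_mod_cast hn
  set y := Real.exp (-(2 * u / (m * n))) with hy
  have hy0 : 0 < y := Real.exp_pos _
  have e1 : Real.exp (-(2 * ((m : ℝ) / n * u))) = y ^ (m * m) := by
    rw [hy, ← Real.exp_nat_mul]; congr 1; push_cast; field_simp
  have e2 : Real.exp (-(2 * (u / ((m : ℝ) / n)))) = y ^ (n * n) := by
    rw [hy, ← Real.exp_nat_mul]; congr 1; push_cast; field_simp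
  have e3 : Real.exp (-(2 * u)) = y ^ (m * n) := by
    rw [hy, ← Real.exp_nat_mul]; congr 1; push_cast; field_simp
  have p1 : 0 < 1 + y ^ (m * m) := by positivity
  have p2 : 0 < 1 + y ^ (n * n) := by positivity
  have p3 : 0 < 1 + y ^ (m * n) := by positivity
  have key : Polynomial.aeval y (critPoly m n) = n * logRSlope ((m : ℝ) / n) u *
      ((1 + y ^ (m * m)) * (1 + y ^ (n * n)) * (1 + y ^ (m * n))) := by
    rw [logRSlope, tanh_eq_exp, tanh_eq_exp, tanh_eq_exp, e1, e2, e3]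
    simp only [critPoly, map_sub, map_add, map_mul, map_one, map_pow, Polynomial.aeval_X,
      map_natCast]
    field_simp
  rw [key]
  constructor
  · intro h
    simpa [hn'.ne', p1.ne', p2.ne', p3.ne'] using h
  · intro h
    rw [h]; ring

lemma isAlgebraic_rpow {x : ℝ} (hx : 0 ≤ x) (h : IsAlgebraic ℚ x) (m : ℕ) {n : ℕ} (hn : 0 < n) :
    IsAlgebraic ℚ (x ^ ((m : ℝ) / n)) := by
  have hn' : (n : ℝ) ≠ 0 := by exact_mod_cast hn.ne'
  apply IsAlgebraic.of_pow hn
  rw [← Real.rpow_natCast, ← Real.rpow_mul hx, div_mul_cancel₀ _ hn', Real.rpow_natCast]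
  exact h.pow m

lemma isAlgebraic_of_eq_natCast_div {p : ℝ} {m n : ℕ} (hm : 0 < m) (hn : 0 < n)
    (hpmn : p - 1 = (m : ℝ) / n) (hp2 : p ≠ 2) :
    IsAlgebraic ℚ (recenterB p) ∧ IsAlgebraic ℚ (recenterT p (recenterB p)) ∧
      IsAlgebraic ℚ (recenterC p) := by
  have hm' : (0 : ℝ) < m := by exact_mod_cast hm
  have hn' : (0 : ℝ) < n := by exact_mod_cast hn
  have hp : 1 < p := by
    have : 0 < (m : ℝ) / n := by positivity
    linarith
  have hB := mem_Ioo_one (isRecenterPeak_recenterB hp hp2).1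
  have h1 : 0 < 1 - recenterB p := by linarith [hB.2]
  set u := halfLogit (recenterB p) with hu
  -- the polynomial is not zero because `logRSlope` is not identically zero
  have hne : critPoly m n ≠ 0 := by
    obtain ⟨v, hv, -, h2⟩ := exists_logRSlope_sign (s := p - 1) (by linarith)
      (fun h => hp2 (by linarith))
    have h3 := h2 (v + 1) (by linarith)
    intro h0
    rw [hpmn] at h3
    exact h3.ne ((aeval_critPoly_eq_zero_iff hm hn _).1 (by rw [h0, map_zero]))
  have hy : IsAlgebraic ℚ (Real.exp (-(2 * u / (m * n)))) := by
    refine ⟨critPoly m n, hne, (aeval_critPoly_eq_zero_iff hm hn _).2 ?_⟩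
    rw [← hpmn]
    exact logRSlope_recenterB hp hp2
  have hone : IsAlgebraic ℚ (1 : ℝ) := isAlgebraic_one
  have hx : IsAlgebraic ℚ (Real.exp (-(2 * u))) := by
    have := hy.pow (m * n)
    rwa [← Real.exp_nat_mul, show ((m * n : ℕ) : ℝ) * -(2 * u / (m * n)) = -(2 * u) by
      push_cast; field_simp] at this
  have hb : IsAlgebraic ℚ (recenterB p) := by
    have e : recenterB p = Real.exp (-(2 * u)) * (1 + Real.exp (-(2 * u)))⁻¹ := by
      rw [← halfLogistic_halfLogit hB, ← hu, halfLogistic, Real.cosh_eq]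
      have h : Real.exp (-(2 * u)) = Real.exp (-u) / Real.exp u := by
        rw [← Real.exp_sub]; congr 1; ring
      have := Real.exp_pos u
      have := Real.exp_pos (-u)
      rw [h]
      field_simp
    rw [e]
    exact hx.mul (hone.add hx).inv
  have hb1 : IsAlgebraic ℚ (1 - recenterB p) := hone.sub hb
  have hinv : 1 / (p - 1) = (n : ℝ) / m := by rw [hpmn, one_div_div]
  have hbr := isAlgebraic_rpow hB.1.le hb n hm
  have hS := hbr.add (isAlgebraic_rpow h1.le hb1 n hm)
  refine ⟨hb, ?_, ?_⟩
  · rw [recenterT, hinv, div_eq_mul_inv]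
    exact hb.sub (hbr.mul hS.inv)
  · rw [recenterC_eq hp hp2, recenterR, hinv, hpmn]
    exact ((isAlgebraic_rpow hB.1.le hb m hn).add (isAlgebraic_rpow h1.le hb1 m hn)).mul
      (isAlgebraic_rpow (by
        have := hB.1
        positivity) hS m hn)

lemma exists_natCast_div {p : ℚ} (hp : 1 < p) :
    ∃ m n : ℕ, 0 < m ∧ 0 < n ∧ (p : ℝ) - 1 = (m : ℝ) / n := by
  have h : 0 < (p - 1).num := Rat.num_pos.2 (by linarith)
  refine ⟨(p - 1).num.toNat, (p - 1).den, by omega, (p - 1).den_pos, ?_⟩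
  have h1 : (((p - 1).num.toNat : ℤ) : ℝ) = ((p - 1).num : ℝ) := by
    rw [Int.toNat_of_nonneg h.le]
  have h2 : (p : ℝ) - 1 = ((p - 1 : ℚ) : ℝ) := by push_cast; ring
  rw [h2, Rat.cast_def, ← h1, Int.cast_natCast]

lemma isAlgebraic_of_rat {p : ℚ} (hp : 1 < p) :
    IsAlgebraic ℚ (recenterC p) ∧
      (p ≠ 2 → IsAlgebraic ℚ (recenterB p) ∧ IsAlgebraic ℚ (recenterT p (recenterB p))) := by
  obtain ⟨m, n, hm, hn, h⟩ := exists_natCast_div hp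
  by_cases hp2 : p = 2
  · subst hp2
    refine ⟨?_, fun h => absurd rfl h⟩
    rw [Rat.cast_ofNat, recenterC_two]
    exact isAlgebraic_one
  · obtain ⟨h1, h2, h3⟩ := isAlgebraic_of_eq_natCast_div hm hn h (by exact_mod_cast hp2)
    exact ⟨h3, fun _ => ⟨h1, h2⟩⟩

/-- The parameter of the maximizer for `p = 3`: the critical equation is
`y ^ 4 - 2 y ^ 3 - 4 y ^ 2 - 2 y + 1 = 0` in `y = exp (-u)`, which is quadratic in
`y + 1 / y = 2 cosh u`. -/
lemma exists_peak_param_three : ∃ y : ℝ, 0 < y ∧ y < 1 ∧ y ^ 2 + 1 = (1 + √7) * y ∧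
    recenterB 3 = y / (1 + √7) ∧ 1 - recenterB 3 = 1 / (y * (1 + √7)) := by
  have hw : √7 ^ 2 = (7 : ℝ) := Real.sq_sqrt (by norm_num)
  have hw2 : 2 < √7 := Real.lt_sqrt_of_sq_lt (by norm_num)
  have hz : 1 < (1 + √7) / 2 := by linarith
  set u := Real.arcosh ((1 + √7) / 2) with hu
  have hcosh : 2 * Real.cosh u = 1 + √7 := by
    rw [hu, Real.cosh_arcosh hz.le]; ring
  have hu0 : 0 < u := Real.arcosh_pos hz
  have hyy : Real.exp u * Real.exp (-u) = 1 := by rw [← Real.exp_add]; simp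
  have hy0 := Real.exp_pos (-u)
  have hsum : Real.exp u + Real.exp (-u) = 1 + √7 := by
    rw [← hcosh, Real.cosh_eq]; ring
  set y := Real.exp (-u) with hy
  have hy1 : y < 1 := by rw [hy, Real.exp_lt_one_iff]; linarith
  have hq : y ^ 2 + 1 = (1 + √7) * y := by rw [← hsum]; linear_combination -hyy
  have quartic : y ^ 4 - 2 * y ^ 3 - 4 * y ^ 2 - 2 * y + 1 = 0 := by
    linear_combination (y ^ 2 + 1 + (1 + √7) * y - 2 * y) * hq + y ^ 2 * hw
  have hs0 : logRSlope (3 - 1) u = 0 := by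
    have e1 : Real.exp (-(2 * ((3 - 1 : ℝ) * u))) = y ^ 4 := by
      rw [hy, ← Real.exp_nat_mul]; congr 1; push_cast; ring
    have e2 : Real.exp (-(2 * (u / (3 - 1 : ℝ)))) = y := by
      rw [hy]; congr 1; ring
    have e3 : Real.exp (-(2 * u)) = y ^ 2 := by
      rw [hy, ← Real.exp_nat_mul]; congr 1; push_cast; ring
    rw [logRSlope, tanh_eq_exp, tanh_eq_exp, tanh_eq_exp, e1, e2, e3]
    have e4 : (3 - 1 : ℝ) * ((1 - y ^ 4) / (1 + y ^ 4)) + (1 - y) / (1 + y) -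
        (3 - 1 + 1) * ((1 - y ^ 2) / (1 + y ^ 2)) =
        -2 * y * (1 - y) * (y ^ 4 - 2 * y ^ 3 - 4 * y ^ 2 - 2 * y + 1) /
          ((1 + y ^ 4) * (1 + y) * (1 + y ^ 2)) := by
      field_simp
      ring
    rw [e4, quartic]
    simp
  have hB := recenterB_eq_of_logRSlope_eq_zero (p := 3) (by norm_num) (by norm_num) hu0 hs0
  refine ⟨y, hy0, hy1, hq, ?_, ?_⟩
  · rw [hB, halfLogistic, hcosh]
  · rw [hB, one_sub_halfLogistic, hcosh, ← div_div]
    congr 1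
    rw [eq_div_iff hy0.ne', hyy]

lemma sqrt_seven_bounds : (2.64575 : ℝ) < √7 ∧ √7 < 2.64576 := by
  constructor
  · exact Real.lt_sqrt_of_sq_lt (by norm_num)
  · rw [Real.sqrt_lt' (by norm_num)]; norm_num

lemma recenterB_three : recenterB 3 = 1 / 2 - 1 / 6 * √(1 + 2 * √7) := by
  obtain ⟨y, hy0, hy1, hq, hB, hB'⟩ := exists_peak_param_three
  have hw : √7 ^ 2 = (7 : ℝ) := Real.sq_sqrt (by norm_num)
  have hw0 : 0 ≤ √7 := Real.sqrt_nonneg 7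
  have hz : 1 + √7 ≠ 0 := by positivity
  have hlt := (isRecenterPeak_recenterB (p := 3) (by norm_num) (by norm_num)).1.2
  have hprod : recenterB 3 * (1 - recenterB 3) = (4 - √7) / 18 := by
    rw [hB', hB]
    field_simp
    linear_combination (√7 - 2) * hw
  have : √(1 + 2 * √7) = 3 * (1 - 2 * recenterB 3) := by
    rw [show 1 + 2 * √7 = (3 * (1 - 2 * recenterB 3)) ^ 2 by linear_combination 36 * hprod,
      Real.sqrt_sq (by linarith)]
  linarith

lemma recenterC_three : recenterC 3 = (17 + 7 * √7) / 27 := by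
  obtain ⟨y, hy0, hy1, hq, hB, hB'⟩ := exists_peak_param_three
  have hw : √7 ^ 2 = (7 : ℝ) := Real.sq_sqrt (by norm_num)
  have hw0 : 0 ≤ √7 := Real.sqrt_nonneg 7
  have hz : 1 + √7 ≠ 0 := by positivity
  have hbmem := mem_Ioo_one (isRecenterPeak_recenterB (p := 3) (by norm_num) (by norm_num)).1
  have hprod : recenterB 3 * (1 - recenterB 3) = (1 / (1 + √7)) ^ 2 := by
    rw [hB', hB]
    field_simp
  rw [recenterC_eq (by norm_num) (by norm_num), recenterR]
  set b := recenterB 3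
  have h0 := hbmem.1
  have h1 : 0 < 1 - b := by linarith [hbmem.2]
  have hs : √b * √(1 - b) = 1 / (1 + √7) := by
    rw [← Real.sqrt_mul h0.le, hprod, Real.sqrt_sq (by positivity)]
  rw [show (3 : ℝ) - 1 = 2 by norm_num, Real.rpow_two, Real.rpow_two, Real.rpow_two,
    ← Real.sqrt_eq_rpow, ← Real.sqrt_eq_rpow]
  have e1 : (√b + √(1 - b)) ^ 2 = 1 + 2 * (1 / (1 + √7)) := by
    rw [← hs]
    linear_combination Real.sq_sqrt h0.le + Real.sq_sqrt h1.le
  have e2 : b ^ 2 + (1 - b) ^ 2 = 1 - 2 * (1 / (1 + √7)) ^ 2 := by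
    rw [← hprod]; ring
  have e3 : 1 / (1 + √7) = (√7 - 1) / 6 := by
    rw [div_eq_div_iff hz (by norm_num)]; linear_combination -hw
  rw [e1, e2, e3]
  linear_combination (-√7 / 54) * hw

lemma recenterT_three :
    recenterT 3 (recenterB 3) = -(1 / 3) * √(1 / 2 * (13 * √7 - 34)) := by
  obtain ⟨y, hy0, hy1, hq, hB, hB'⟩ := exists_peak_param_three
  have hw : √7 ^ 2 = (7 : ℝ) := Real.sq_sqrt (by norm_num)
  have hw1 := sqrt_seven_bounds.1
  have hz : 0 < 1 + √7 := by positivity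
  have hbmem := mem_Ioo_one (isRecenterPeak_recenterB (p := 3) (by norm_num) (by norm_num)).1
  have hT : recenterT 3 (recenterB 3) = y / (1 + √7) - y / (1 + y) := by
    have h0 := hbmem.1
    have h1 : 0 < 1 - recenterB 3 := by linarith [hbmem.2]
    rw [recenterT, show (3 : ℝ) - 1 = 2 by norm_num, ← Real.sqrt_eq_rpow, ← Real.sqrt_eq_rpow]
    have e : √(recenterB 3) = y * √(1 - recenterB 3) := by
      have e' : recenterB 3 = y ^ 2 * (1 - recenterB 3) := by
        rw [hB', hB]
        field_simp
      calc √(recenterB 3) = √(y ^ 2 * (1 - recenterB 3)) := congrArg _ e'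
        _ = _ := by rw [Real.sqrt_mul (by positivity), Real.sqrt_sq hy0.le]
    have h2 : 0 < √(1 - recenterB 3) := Real.sqrt_pos.2 h1
    rw [e, ← hB]
    congr 1
    field_simp
    ring
  have hT2 : recenterT 3 (recenterB 3) ^ 2 = (13 * √7 - 34) / 18 := by
    have e1 : (1 + y) ^ 2 = (3 + √7) * y := by linear_combination hq
    have e2 : y * (y - √7) ^ 2 = √7 - 1 := by linear_combination (y + 1 - √7) * hq
    calc recenterT 3 (recenterB 3) ^ 2
        = y * (y * (y - √7) ^ 2) / ((1 + √7) ^ 2 * (1 + y) ^ 2) := by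
          rw [hT]
          field_simp
          ring
      _ = y * (√7 - 1) / ((1 + √7) ^ 2 * ((3 + √7) * y)) := by rw [e2, e1]
      _ = (13 * √7 - 34) / 18 := by
          rw [div_eq_div_iff (by positivity) (by norm_num)]
          linear_combination (-y * (13 * √7 ^ 2 + 31 * √7 + 12)) * hw
  have hneg : recenterT 3 (recenterB 3) ≤ 0 := by
    rw [hT, sub_nonpos]
    apply div_le_div_of_nonneg_left hy0.le (by positivity)
    linarith
  have : √(1 / 2 * (13 * √7 - 34)) = -3 * recenterT 3 (recenterB 3) := by
    rw [show 1 / 2 * (13 * √7 - 34) = (-3 * recenterT 3 (recenterB 3)) ^ 2 by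
      rw [mul_pow, hT2]; ring, Real.sqrt_sq (by linarith)]
  rw [this]
  ring

lemma recenterC_three_mem : recenterC 3 ∈ Ico (1.315 : ℝ) 1.316 := by
  obtain ⟨h1, h2⟩ := sqrt_seven_bounds
  rw [recenterC_three]
  constructor <;> linarith

lemma recenterB_three_mem : recenterB 3 ∈ Ico (0.0819 : ℝ) 0.0820 := by
  obtain ⟨h1, h2⟩ := sqrt_seven_bounds
  rw [recenterB_three]
  have h3 : 2.508 < √(1 + 2 * √7) := Real.lt_sqrt_of_sq_lt (by norm_num; linarith)
  have h4 : √(1 + 2 * √7) < 2.5086 := by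
    rw [Real.sqrt_lt' (by norm_num)]; norm_num; linarith
  constructor <;> linarith

lemma recenterT_three_mem : recenterT 3 (recenterB 3) ∈ Ioc (-0.149 : ℝ) (-0.148) := by
  obtain ⟨h1, h2⟩ := sqrt_seven_bounds
  rw [recenterT_three]
  have h3 : 0.444 < √(1 / 2 * (13 * √7 - 34)) := Real.lt_sqrt_of_sq_lt (by norm_num; linarith)
  have h4 : √(1 / 2 * (13 * √7 - 34)) < 0.447 := by
    rw [Real.sqrt_lt' (by norm_num)]; norm_num; linarith
  constructor <;> linarith

end Recenter

theorem mainTheorem3 :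
    -- the point `b_p` is well defined and is the unique maximizer of `R(p, ·)` on `[0, 1/2]`
    (∀ p : ℝ, 1 < p → p ≠ 2 →
      (∀ b : ℝ, IsRecenterPeak p b ↔ b = recenterB p) ∧
      StrictMonoOn (recenterR p) (Icc 0 (recenterB p)) ∧
      StrictAntiOn (recenterR p) (Icc (recenterB p) (1 / 2)) ∧
      (∀ b ∈ Icc (0 : ℝ) (1 / 2), b ≠ recenterB p →
        recenterR p b < recenterR p (recenterB p))) ∧
    -- (i) the inequality and the expressions for `C_p`
    (∀ p : ℝ, 1 < p →
      (∀ (Ω : Type u) [MeasurableSpace Ω] (P : Measure Ω) [IsProbabilityMeasure P] (X : Ω → ℝ),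
        Integrable X P →
        absMoment P p (fun ω => X ω - ∫ ω', X ω' ∂P) ≤
          ENNReal.ofReal (recenterC p) * absMoment P p X) ∧
      recenterConst (fun x => |x| ^ p) = ENNReal.ofReal (recenterC p) ∧
      IsLUB (recenterR p '' Icc 0 1) (recenterC p) ∧
      IsGreatest (recenterR p '' Ioo 0 (1 / 2)) (recenterC p) ∧
      (p ≠ 2 → recenterC p = recenterR p (recenterB p))) ∧
    (recenterC 2 = 1 ∧ ∀ b ∈ Icc (0 : ℝ) 1, recenterR 2 b = 1) ∧
    -- (ii) `C_p` is the best possible constant, and the cases of equality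
    (∀ p : ℝ, 1 < p →
      (∀ c : ℝ≥0∞,
        (∀ (Ω : Type) [MeasurableSpace Ω] (P : Measure Ω) [IsProbabilityMeasure P] (X : Ω → ℝ),
          Integrable X P →
          absMoment P p (fun ω => X ω - ∫ ω', X ω' ∂P) ≤ c * absMoment P p X) →
        ENNReal.ofReal (recenterC p) ≤ c) ∧
      (∀ (Ω : Type u) [MeasurableSpace Ω] (P : Measure Ω) [IsProbabilityMeasure P] (X : Ω → ℝ),
        Integrable X P →
        (absMoment P p (fun ω => X ω - ∫ ω', X ω' ∂P) =
            ENNReal.ofReal (recenterC p) * absMoment P p X ↔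
          absMoment P p X = ∞ ∨
          (p = 2 ∧ absMoment P 2 X < ∞ ∧ ∫ ω, X ω ∂P = 0) ∨
          (p ≠ 2 ∧ ∃ l : ℝ, P.map X =
            (twoPointLaw (1 - recenterB p) (recenterB p)).map
              (fun x => l * (x - recenterT p (recenterB p))))))) ∧
    -- (iii) duality
    (∀ p q : ℝ, 1 < p → 1 / p + 1 / q = 1 →
      recenterC p ^ (1 / √(p - 1)) = recenterC q ^ (1 / √(q - 1)) ∧
      (p ≠ 2 → recenterB p = recenterB q)) ∧
    -- (iv) asymptotics
    Tendsto (fun p : ℝ => recenterC p / (2 ^ p / √(8 * Real.exp 1 * p))) atTop (𝓝 1) ∧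
    -- (v) strict log-convexity, continuity and monotonicity
    ((∀ p : ℝ, 1 < p → 0 < recenterC p) ∧
      StrictConvexOn ℝ (Ioi 1) (fun p => Real.log (recenterC p)) ∧
      ContinuousOn recenterC (Ioi 1) ∧
      StrictAntiOn recenterC (Ioc 1 2) ∧
      Tendsto recenterC (𝓝[>] 1) (𝓝 2) ∧
      StrictMonoOn recenterC (Ici 2) ∧
      Tendsto recenterC atTop atTop) ∧
    -- (vi) algebraicity and the values at `p = 3`
    (∀ p : ℚ, 1 < p →
      IsAlgebraic ℚ (recenterC p) ∧
      (p ≠ 2 → IsAlgebraic ℚ (recenterB p) ∧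
        IsAlgebraic ℚ (recenterT p (recenterB p)))) ∧
    (recenterC 3 = (17 + 7 * √7) / 27 ∧ recenterC 3 ∈ Ico (1.315 : ℝ) 1.316) ∧
    (recenterB 3 = 1 / 2 - 1 / 6 * √(1 + 2 * √7) ∧ recenterB 3 ∈ Ico (0.0819 : ℝ) 0.0820) ∧
    (recenterT 3 (recenterB 3) = -(1 / 3) * √(1 / 2 * (13 * √7 - 34)) ∧
      recenterT 3 (recenterB 3) ∈ Ioc (-0.149 : ℝ) (-0.148)) := by
  refine ⟨fun p hp hp2 => ⟨Recenter.isRecenterPeak_iff hp hp2,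
      Recenter.strictMonoOn_recenterR hp hp2, Recenter.strictAntiOn_recenterR hp hp2,
      fun b hb hne => Recenter.recenterR_lt_of_ne hp hp2 hb hne⟩,
    fun p hp => ⟨?_, Recenter.recenterConst_eq hp, Recenter.isLUB_recenterC hp,
      Recenter.isGreatest_recenterC hp, Recenter.recenterC_eq hp⟩,
    ⟨Recenter.recenterC_two, fun b _ => Recenter.recenterR_two b⟩,
    fun p hp => ⟨?_, ?_⟩,
    fun p q hp hpq => Recenter.duality hp hpq,
    Recenter.tendsto_recenterC_div,
    ⟨fun p hp => Recenter.recenterC_pos hp, Recenter.strictConvexOn_log_recenterC,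
      Recenter.continuousOn_recenterC, Recenter.strictAntiOn_recenterC,
      Recenter.tendsto_recenterC_one, Recenter.strictMonoOn_recenterC,
      Recenter.tendsto_recenterC_atTop⟩,
    fun p hp => Recenter.isAlgebraic_of_rat hp,
    ⟨Recenter.recenterC_three, Recenter.recenterC_three_mem⟩,
    ⟨Recenter.recenterB_three, Recenter.recenterB_three_mem⟩,
    ⟨Recenter.recenterT_three, Recenter.recenterT_three_mem⟩⟩
  · intro Ω _ P _ X hX
    exact Recenter.centered_le hp hX
  · intro c hc
    exact Recenter.le_of_forall_centered_le hp hc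
  · intro Ω _ P _ X hX
    exact Recenter.centered_eq_iff hp hX
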